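/- Let $d,m\ge 1$, $\hat\alpha=(\alpha_1,\dots,\alpha_d)\in(0,1]^d$, $r_1,\dots,r_m\ge 0$, $r=\max_j r_j$, and let $\tau_j:[0,\infty)\to[0,r_j]$ be continuous for $j=1,\dots,m$. For $x,y\in\mathbb R^d$ write $x\preceq y$ (resp. $x\prec y$) if $x_i\le y_i$ (resp. $x_i<y_i$) for all $i$. Consider the system $$ {}^{C}D^{\hat\alpha}_{0^+}w(t)=f(w(t))+\sum_{j=1}^m g^{(j)}(w(t-\tau_j(t)))\quad (t>0),\qquad w(s)=\varphi(s)\quad (s\in[-r,0]), $$ where the $i$-th component of the left-hand side is the Caputo derivative ${}^{C}D^{\alpha_i}_{0^+}w_i(t)=\frac{d}{dt}I^{1-\alpha_i}_{0^+}(w_i-w_i(0))(t)$, with $I^{\beta}_{0^+}x(t)=\frac1{\Gamma(\beta)}\int_0^t(t-s)^{\beta-1}x(s)\,ds$ for $\beta>0$ and $I^0_{0^+}x=x$. A solution on $[0,T)$, $0<T\le\infty$, is a continuous function $w:[-r,T)\to\mathbb R^d$ that satisfies the equation for $0<t<T$ and equals $\varphi$ on $[-r,0]$. Assume: * **(H1)**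 $f:\mathbb R^d\to\mathbb R^d$ is continuous, continuously differentiable on $\mathbb R^d\setminus\{0\}$, cooperative (all off-diagonal entries of the Jacobian matrix $Df(x)$ are nonnegative for every $x\in\mathbb R^d_{\ge0}\setminus\{0\}$), and homogeneous of degree $p\ge1$, i.e. $f(\lambda x)=\lambda^pf(x)$ for all $\lambda>0$, $x\in\mathbb R^d$. * **(H2)** Each $g^{(j)}:\mathbb R^d\to\mathbb R^d$ is continuous, continuously differentiable on $\mathbb R^d\setminus\{0\}$, order-preserving on $\mathbb R^d_{\ge0}$ (if $0\preceq y\preceq x$ then $g^{(j)}(y)\preceq g^{(j)}(x)$), and homogeneous of degree $q_j\ge p$. * **(S)** $v\in\mathbb R^d$ is a vector with $v\succ0$ and $f(v)+\sum_{j=1}^m g^{(j)}(v)\prec0$. Put $\|w\|_v=\max_{1\le i\le d}|w_i|/v_i$ for $w\in\mathbb R^d$ and $\|\varphi\|_v=\max_{s\in[-r,0]}\|\varphi(s)\|_v$ for $\varphi\in C([-r,0];\mathbb R^d)$. Then: 1. If $q_j>p$ for some $j$, then for every $\varphi\in C([-r,0];\mathbb R^d_{\ge0})$ with $\|\varphi\|_v<1$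 the system has a unique solution $\Phi(\cdot,\varphi)$, it exists globally on $[0,\infty)$, and $\Phi(t,\varphi)\succeq0$ and $\|\Phi(t,\varphi)\|_v\le\|\varphi\|_v$ for all $t\ge0$. 2. If $q_j=p$ for all $j=1,\dots,m$, then the same conclusions hold for every $\varphi\in C([-r,0];\mathbb R^d_{\ge0})$, without any restriction on $\|\varphi\|_v$. Here uniqueness means that every solution on an interval $[0,T)$, $0<T\le\infty$, is the restriction of $\Phi(\cdot,\varphi)$ to $[-r,T)$. -/

import Mathlib

noncomputable section

namespace FracDelay

/-- Riemann-Liouville fractional integral with lower limit `0`,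
`I^β x (t) = 1/Γ(β) ∫₀ᵗ (t-s)^(β-1) x(s) ds` for `β > 0`, with the usual convention `I^0 = id`
(which is needed for the Caputo derivative of order one). -/
def rlIntegral (β : ℝ) (x : ℝ → ℝ) (t : ℝ) : ℝ :=
  if β = 0 then x t
  else 1 / Real.Gamma β * ∫ s in (0 : ℝ)..t, (t - s) ^ (β - 1) * x s

/-- The Caputo derivative of order `α ∈ (0,1]` of `x` exists at `t` and equals `y`:
`y = d/dt I^(1-α) (x - x(0)) (t)`. -/
def HasCaputoDerivAt (α : ℝ) (x : ℝ → ℝ) (y t : ℝ) : Prop :=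
  HasDerivAt (rlIntegral (1 - α) (fun s => x s - x 0)) y t

/-- Homogeneous vector field of degree `p`. -/
def IsHomogeneous {d : ℕ} (p : ℝ) (f : (Fin d → ℝ) → (Fin d → ℝ)) : Prop :=
  ∀ (x : Fin d → ℝ) (c : ℝ), 0 < c → f (c • x) = c ^ p • f x

/-- Cooperative vector field: continuous, continuously differentiable off the origin, and with a
Metzler Jacobian matrix (nonnegative off-diagonal entries `∂f_i/∂x_k`) at every nonzero point of
the nonnegative orthant. -/
structure IsCooperative {d : ℕ} (f : (Fin d → ℝ) → (Fin d → ℝ)) : Prop where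
  continuous : Continuous f
  contDiffOn : ContDiffOn ℝ 1 f {0}ᶜ
  metzler : ∀ x : Fin d → ℝ, 0 ≤ x → x ≠ 0 →
    ∀ i k : Fin d, i ≠ k → 0 ≤ fderiv ℝ f x (Pi.single k 1) i

/-- The weighted norm `‖w‖_v = max_i |w_i| / v_i`. -/
def wnorm {d : ℕ} (v w : Fin d → ℝ) : ℝ := ⨆ i, |w i| / v i

/-- The norm `‖φ‖_v = max_{-r ≤ s ≤ 0} ‖φ(s)‖_v` of an initial function. -/
def histNorm {d : ℕ} {r : ℝ} (v : Fin d → ℝ) (φ : C(Set.Icc (-r) 0, Fin d → ℝ)) : ℝ :=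
  ⨆ s, wnorm v (φ s)

/-- `w` solves, on the time interval `[0, T)` with `T ≤ ∞`, the delay system
`^C D^α w(t) = f(w(t)) + ∑_j g_j(w(t - τ_j(t)))` for `0 < t < T`, with `w = φ` on `[-r, 0]`.
Only the values of `w` on `[-r, T)` matter, where `w` has to be continuous. -/
structure IsSolutionOn {d m : ℕ} (α : Fin d → ℝ) (f : (Fin d → ℝ) → (Fin d → ℝ))
    (g : Fin m → (Fin d → ℝ) → (Fin d → ℝ)) (τ : Fin m → ℝ → ℝ) {r : ℝ}
    (φ : C(Set.Icc (-r) 0, Fin d → ℝ)) (T : EReal) (w : ℝ → Fin d → ℝ) : Prop where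
  continuousOn : ContinuousOn w {t : ℝ | -r ≤ t ∧ (t : EReal) < T}
  initial : ∀ s : Set.Icc (-r) 0, w s = φ s
  equation : ∀ t : ℝ, 0 < t → (t : EReal) < T → ∀ i : Fin d,
    HasCaputoDerivAt (α i) (fun s => w s i) (f (w t) i + ∑ j, g j (w (t - τ j t)) i) t

/-- `w` is the unique solution of the initial value problem and it is global: it solves the problem
on `[0, ∞)`, and every solution on some `[0, T)` with `0 < T ≤ ∞` is a restriction of `w`. -/
structure IsGlobalSolution {d m : ℕ} (α : Fin d → ℝ) (f : (Fin d → ℝ) → (Fin d → ℝ))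
    (g : Fin m → (Fin d → ℝ) → (Fin d → ℝ)) (τ : Fin m → ℝ → ℝ) {r : ℝ}
    (φ : C(Set.Icc (-r) 0, Fin d → ℝ)) (w : ℝ → Fin d → ℝ) : Prop where
  solution : IsSolutionOn α f g τ φ ⊤ w
  unique : ∀ (T : EReal) (u : ℝ → Fin d → ℝ), 0 < T → IsSolutionOn α f g τ φ T u →
    ∀ t : ℝ, -r ≤ t → (t : EReal) < T → u t = w t

end FracDelay

end

namespace FracDelay

open MeasureTheory Set Filter Topology

/-! Write `c` for `histNorm v φ`. The point is that the box `[0, c • v]`, which contains the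
history, is invariant. By homogeneity the field at its upper corner is `c ^ p • f v + ∑ j, c ^ q j •
g j v`. Since `c ^ q j ≤ c ^ p` (because `c < 1`, or because the degrees agree) and `g j v ≥ 0`,
this is at most `c ^ p` times the negative vector of (S). Cooperativity and monotonicity carry the
sign from the corner to the whole upper faces, and they make the field nonnegative on the lower
faces.

To get a solution that stays in the box, the field is evaluated at the truncation `clip e w` and the
restoring term `clip e w - w` is added. The new field is globally Lipschitz, so the associated
Volterra equation has a global solution by contraction in a norm weighted by `exp (-(lam * t))`
(`exists_volterra_solution`). Outside the box the restoring term makes the relevant component point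
strictly inwards. A fractional minimum principle (`not_pos_at_strict_minimum`) then forbids leaving
the box, and inside it the truncated field is the original one (`exists_solution_in_box`).

The Caputo problem and the Volterra equation are exchanged through the identity `I^(1-α) I^α = I^1`.
Homogeneous fields of degree at least one that are `C¹` off the origin are Lipschitz on balls, so
uniqueness follows from the same weighted estimate. -/

/-! ### Fractional integrals: continuity and exponential bounds. -/

theorem rlIntegral_of_ne {β : ℝ} (hβ : β ≠ 0) (x : ℝ → ℝ) (t : ℝ) :
    rlIntegral β x t = 1 / Real.Gamma β * ∫ s in (0 : ℝ)..t, (t - s) ^ (β - 1) * x s := by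
  simp [rlIntegral, hβ]

theorem rlIntegral_zero (x : ℝ → ℝ) (t : ℝ) : rlIntegral 0 x t = x t := by
  simp [rlIntegral]

theorem rlIntegral_one (x : ℝ → ℝ) (t : ℝ) : rlIntegral 1 x t = ∫ s in (0 : ℝ)..t, x s := by
  simp [rlIntegral]

theorem rlIntegral_congr {β t : ℝ} {x y : ℝ → ℝ} (ht : 0 ≤ t) (h : ∀ s ∈ Icc 0 t, x s = y s) :
    rlIntegral β x t = rlIntegral β y t := by
  unfold rlIntegral
  split_ifs with hβ
  · exact h t ⟨ht, le_rfl⟩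
  · congr 1
    refine intervalIntegral.integral_congr fun s hs => ?_
    rw [uIcc_of_le ht] at hs
    simp only [h s hs]

theorem intervalIntegrable_sub_rpow {β : ℝ} (hβ : 0 < β) (t a b : ℝ) :
    IntervalIntegrable (fun s => (t - s) ^ (β - 1)) volume a b := by
  have h := (intervalIntegral.intervalIntegrable_rpow' (a := t - a) (b := t - b)
    (r := β - 1) (by linarith)).comp_sub_left t
  simpa using h

theorem intervalIntegrable_sub_rpow_mul {β : ℝ} (hβ : 0 < β) {x : ℝ → ℝ} {a b : ℝ}
    (t : ℝ) (hx : ContinuousOn x (uIcc a b)) :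
    IntervalIntegrable (fun s => (t - s) ^ (β - 1) * x s) volume a b :=
  (intervalIntegrable_sub_rpow hβ t a b).mul_continuousOn hx

theorem integral_sub_rpow {β : ℝ} (hβ : 0 < β) {a t : ℝ} :
    ∫ s in a..t, (t - s) ^ (β - 1) = (t - a) ^ β / β := by
  rw [intervalIntegral.integral_comp_sub_left (fun s => s ^ (β - 1)) t,
    integral_rpow (Or.inl (by linarith))]
  simp [Real.zero_rpow hβ.ne']

/-- The substitution `s = t * σ` moves `t` out of the singular kernel and the limits of integration.
Continuity in `t` then becomes a dominated convergence argument with a fixed majorant. -/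
theorem rlIntegral_scaled {β t : ℝ} (hβ : 0 < β) (ht : 0 ≤ t) (x : ℝ → ℝ) :
    rlIntegral β x t =
      1 / Real.Gamma β * (t ^ β * ∫ σ in (0 : ℝ)..1, (1 - σ) ^ (β - 1) * x (t * σ)) := by
  rw [rlIntegral_of_ne hβ.ne']
  congr 1
  rcases ht.eq_or_lt with rfl | ht
  · simp [Real.zero_rpow hβ.ne']
  have h := intervalIntegral.mul_integral_comp_mul_left (a := 0) (b := 1)
    (f := fun s => (t - s) ^ (β - 1) * x s) t
  rw [mul_zero, mul_one] at h
  rw [← h, ← intervalIntegral.integral_const_mul, ← intervalIntegral.integral_const_mul]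
  refine intervalIntegral.integral_congr fun σ hσ => ?_
  rw [uIcc_of_le zero_le_one] at hσ
  have h1 : t - t * σ = t * (1 - σ) := by ring
  have h2 : t ^ β = t * t ^ (β - 1) := by
    rw [← Real.rpow_one_add' ht.le (by simpa using hβ.ne')]; congr 1; ring
  simp only [h1, h2, Real.mul_rpow ht.le (sub_nonneg.2 hσ.2)]
  ring

theorem continuous_rlIntegral {β : ℝ} (hβ : 0 ≤ β) {x : ℝ → ℝ} (hx : Continuous x) :
    Continuous fun t => rlIntegral β x (max t 0) := by
  rcases hβ.eq_or_lt with rfl | hβ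
  · simp only [rlIntegral_zero]; fun_prop
  simp only [fun t => rlIntegral_scaled hβ (le_max_right t 0) x]
  refine continuous_const.mul (Continuous.mul ?_ ?_)
  · exact (Real.continuous_rpow_const hβ.le).comp (by fun_prop)
  have key : Continuous fun t : ℝ => ∫ σ in (0 : ℝ)..1, (1 - σ) ^ (β - 1) * x (t * σ) := by
    refine continuous_iff_continuousAt.2 fun t₀ => ?_
    obtain ⟨M, hM⟩ := (isCompact_closedBall (0 : ℝ) (|t₀| + 1)).exists_bound_of_continuousOn
      hx.continuousOn
    refine intervalIntegral.continuousAt_of_dominated_interval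
      (bound := fun σ => (1 - σ) ^ (β - 1) * M) ?_ ?_ ?_ ?_
    · refine Eventually.of_forall fun t => ?_
      refine Measurable.aestronglyMeasurable ?_
      exact (by fun_prop : Measurable fun σ : ℝ => (1 - σ) ^ (β - 1)).mul
        (hx.measurable.comp (by fun_prop))
    · have : ∀ᶠ t in 𝓝 t₀, |t| < |t₀| + 1 :=
        (continuous_abs.tendsto t₀).eventually (gt_mem_nhds (by simp))
      filter_upwards [this] with t ht
      refine Eventually.of_forall fun σ hσ => ?_
      rw [uIoc_of_le zero_le_one] at hσ
      rw [norm_mul, Real.norm_of_nonneg (Real.rpow_nonneg (sub_nonneg.2 hσ.2) _)]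
      refine mul_le_mul_of_nonneg_left (hM _ ?_) (Real.rpow_nonneg (sub_nonneg.2 hσ.2) _)
      rw [mem_closedBall_zero_iff, Real.norm_eq_abs, abs_mul, abs_of_pos hσ.1]
      nlinarith [abs_nonneg t, hσ.1, hσ.2]
    · exact (intervalIntegrable_sub_rpow hβ 1 0 1).mul_const M
    · refine Eventually.of_forall fun σ _ => ?_
      exact (continuous_const.mul (hx.comp (by fun_prop))).continuousAt
  exact key.comp (by fun_prop)

theorem rlIntegral_at_zero {β : ℝ} (hβ : 0 < β) (x : ℝ → ℝ) : rlIntegral β x 0 = 0 := by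
  simp [rlIntegral_of_ne hβ.ne']

/-- The Laplace transform of the kernel is `Γ(β) lam^(-β)`. Hence `I^β` has norm at most `lam^(-β)`
for the weight `exp (-(lam * t))`, which is small for large `lam`; both existence and uniqueness
rest on this. -/
theorem abs_rlIntegral_le_exp {β lam C t : ℝ} (hβ : 0 < β) (hlam : 0 < lam) (ht : 0 ≤ t)
    {x : ℝ → ℝ} (hx : ∀ s ∈ Icc 0 t, |x s| ≤ C * Real.exp (lam * s)) :
    |rlIntegral β x t| ≤ C * (1 / lam) ^ β * Real.exp (lam * t) := by
  have hC : 0 ≤ C := by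
    have h := (abs_nonneg _).trans (hx 0 ⟨le_rfl, ht⟩)
    simpa using h
  have hΓ := Real.Gamma_pos_of_pos hβ
  have h1 : ‖∫ s in (0 : ℝ)..t, (t - s) ^ (β - 1) * x s‖ ≤
      ∫ s in (0 : ℝ)..t, (t - s) ^ (β - 1) * (C * Real.exp (lam * s)) := by
    refine intervalIntegral.norm_integral_le_of_norm_le ht
      (Eventually.of_forall fun s hs => ?_)
      (intervalIntegrable_sub_rpow_mul hβ t (by fun_prop))
    rw [norm_mul, Real.norm_of_nonneg (Real.rpow_nonneg (sub_nonneg.2 hs.2) _)]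
    exact mul_le_mul_of_nonneg_left (hx s ⟨hs.1.le, hs.2⟩)
      (Real.rpow_nonneg (sub_nonneg.2 hs.2) _)
  have h2 : ∫ s in (0 : ℝ)..t, (t - s) ^ (β - 1) * (C * Real.exp (lam * s)) =
      C * Real.exp (lam * t) * ∫ s in (0 : ℝ)..t, s ^ (β - 1) * Real.exp (-(lam * s)) := by
    have h := intervalIntegral.integral_comp_sub_left (a := 0) (b := t)
      (fun s => s ^ (β - 1) * Real.exp (-(lam * s))) t
    rw [sub_self, sub_zero] at h
    rw [← h, ← intervalIntegral.integral_const_mul]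
    refine intervalIntegral.integral_congr fun s _ => ?_
    have : Real.exp (lam * s) = Real.exp (lam * t) * Real.exp (-(lam * (t - s))) := by
      rw [← Real.exp_add]; congr 1; ring
    simp only [this]; ring
  have h3 : ∫ s in (0 : ℝ)..t, s ^ (β - 1) * Real.exp (-(lam * s)) ≤
      (1 / lam) ^ β * Real.Gamma β := by
    rw [← Real.integral_rpow_mul_exp_neg_mul_Ioi hβ hlam, intervalIntegral.integral_of_le ht]
    refine setIntegral_mono_set ?_ ?_ ?_
    -- Integrability on the half-line is read off the value of the integral: a nonintegrable
    -- function would have integral `0`, and this one is positive.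
    · refine not_imp_comm.1 integral_undef ?_
      rw [Real.integral_rpow_mul_exp_neg_mul_Ioi hβ hlam]
      positivity
    · filter_upwards [self_mem_ae_restrict measurableSet_Ioi] with s hs
      exact mul_nonneg (Real.rpow_nonneg (le_of_lt hs) _) (Real.exp_pos _).le
    · exact (Ioc_subset_Ioi_self).eventuallyLE
  rw [rlIntegral_of_ne hβ.ne', abs_mul, abs_of_pos (by positivity), ← Real.norm_eq_abs]
  calc 1 / Real.Gamma β * ‖∫ s in (0 : ℝ)..t, (t - s) ^ (β - 1) * x s‖
      ≤ 1 / Real.Gamma β * (C * Real.exp (lam * t) * ((1 / lam) ^ β * Real.Gamma β)) := by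
        refine mul_le_mul_of_nonneg_left ?_ (by positivity)
        rw [h2] at h1
        exact h1.trans (mul_le_mul_of_nonneg_left h3 (by positivity))
    _ = C * (1 / lam) ^ β * Real.exp (lam * t) := by field_simp

/-! ### The Beta integral and the composition of complementary fractional integrals. -/

theorem integral_rpow_mul_sub_rpow {α c : ℝ} (h0 : 0 < α) (h1 : α < 1) (hc : 0 < c) :
    ∫ s in (0 : ℝ)..c, s ^ (α - 1) * (c - s) ^ (-α) = Real.Gamma α * Real.Gamma (1 - α) := by
  have hG := Complex.Gamma_mul_Gamma_eq_betaIntegral (s := (α : ℂ)) (t := ((1 - α : ℝ) : ℂ))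
    (by simpa using h0) (by simpa using h1)
  have hs := Complex.betaIntegral_scaled (α : ℂ) ((1 - α : ℝ) : ℂ) hc
  have e : (α : ℂ) + ((1 - α : ℝ) : ℂ) = 1 := by push_cast; ring
  rw [e, sub_self, Complex.cpow_zero, one_mul] at hs
  rw [e, Complex.Gamma_one, one_mul, ← hs, Complex.Gamma_ofReal, Complex.Gamma_ofReal] at hG
  have : ((∫ s in (0 : ℝ)..c, s ^ (α - 1) * (c - s) ^ (-α) : ℝ) : ℂ) =
      ((Real.Gamma α * Real.Gamma (1 - α) : ℝ) : ℂ) := by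
    rw [← intervalIntegral.integral_ofReal, Complex.ofReal_mul, hG]
    refine intervalIntegral.integral_congr fun s hs => ?_
    rw [uIcc_of_le hc.le] at hs
    simp only [Complex.ofReal_mul, Complex.ofReal_cpow hs.1,
      Complex.ofReal_cpow (sub_nonneg.2 hs.2)]
    push_cast
    congr 2
    ring
  exact_mod_cast this

theorem integral_beta_kernel {α r t : ℝ} (h0 : 0 < α) (h1 : α < 1) (hrt : r < t) :
    ∫ s in r..t, (t - s) ^ (-α) * (s - r) ^ (α - 1) = Real.Gamma α * Real.Gamma (1 - α) := by
  rw [← integral_rpow_mul_sub_rpow h0 h1 (sub_pos.2 hrt)]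
  have h := intervalIntegral.integral_comp_sub_right (a := r) (b := t)
    (fun s => s ^ (α - 1) * (t - r - s) ^ (-α)) r
  rw [sub_self] at h
  rw [← h]
  refine intervalIntegral.integral_congr fun s _ => ?_
  simp only [sub_sub_sub_cancel_right]
  ring

/-- Fubini on the triangle `r < s ≤ t`: for fixed `r` the inner integral in `s` is the Beta
integral, whose value `B` depends on neither `r` nor `t`. -/
theorem integral_integral_beta_kernel {α t : ℝ} (h0 : 0 < α) (h1 : α < 1) (ht : 0 ≤ t)
    {x : ℝ → ℝ} (hx : IntervalIntegrable x volume 0 t) :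
    ∫ s in (0 : ℝ)..t, (t - s) ^ (-α) * ∫ r in (0 : ℝ)..s, (s - r) ^ (α - 1) * x r =
      Real.Gamma α * Real.Gamma (1 - α) * ∫ r in (0 : ℝ)..t, x r := by
  set B := Real.Gamma α * Real.Gamma (1 - α) with hB
  have hBpos : 0 < B := mul_pos (Real.Gamma_pos_of_pos h0) (Real.Gamma_pos_of_pos (by linarith))
  set μ := volume.restrict (Ioc (0 : ℝ) t) with hμ
  -- The kernel is cut off to the triangle, so that both integrations run over the same fixed
  -- interval.
  let k : ℝ → ℝ → ℝ := fun s r => (Ioi r).indicator (fun s => (t - s) ^ (-α) * (s - r) ^ (α - 1)) s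
  have hkr : ∀ r ∈ Ioc 0 t, ∫ s, k s r ∂μ = ∫ s in r..t, (t - s) ^ (-α) * (s - r) ^ (α - 1) := by
    intro r hr
    rw [integral_indicator measurableSet_Ioi, hμ, Measure.restrict_restrict measurableSet_Ioi,
      intervalIntegral.integral_of_le hr.2]
    congr 2
    ext s
    simp only [mem_inter_iff, mem_Ioi, mem_Ioc]
    exact ⟨fun h => ⟨h.1, h.2.2⟩, fun h => ⟨h.1, hr.1.trans h.1, h.2⟩⟩
  have hne : ∀ᵐ r ∂μ, r ∈ Ioo 0 t := by
    have : ∀ᵐ r ∂μ, r ≠ t := Measure.ae_ne _ t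
    filter_upwards [self_mem_ae_restrict (measurableSet_Ioc (a := (0 : ℝ)) (b := t)), this]
      with r hr hrt
    exact ⟨hr.1, lt_of_le_of_ne hr.2 hrt⟩
  have hkB : ∀ᵐ r ∂μ, ∫ s, k s r ∂μ = B := by
    filter_upwards [hne] with r hr
    rw [hkr r ⟨hr.1, hr.2.le⟩, integral_beta_kernel h0 h1 hr.2]
  have hknn : ∀ r, ∀ᵐ s ∂μ, 0 ≤ k s r := by
    intro r
    filter_upwards [self_mem_ae_restrict (measurableSet_Ioc (a := (0 : ℝ)) (b := t))] with s hs
    refine indicator_apply_nonneg fun h => ?_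
    exact mul_nonneg (Real.rpow_nonneg (sub_nonneg.2 hs.2) _)
      (Real.rpow_nonneg (sub_nonneg.2 (le_of_lt h)) _)
  have hkm : Measurable fun z : ℝ × ℝ => k z.1 z.2 := by
    have : (fun z : ℝ × ℝ => k z.1 z.2) = {z : ℝ × ℝ | z.2 < z.1}.indicator
        (fun z => (t - z.1) ^ (-α) * (z.1 - z.2) ^ (α - 1)) := by
      ext z; simp [k, indicator_apply]
    rw [this]
    exact Measurable.indicator (by fun_prop) (measurableSet_lt measurable_snd measurable_fst)
  have hxμ : Integrable x μ := (intervalIntegrable_iff_integrableOn_Ioc_of_le ht).1 hx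
  have hint : Integrable (Function.uncurry fun s r => k s r * x r) (μ.prod μ) := by
    have hm : AEStronglyMeasurable (Function.uncurry fun s r => k s r * x r) (μ.prod μ) :=
      hkm.aestronglyMeasurable.mul hxμ.aestronglyMeasurable.comp_snd
    rw [integrable_prod_iff' hm]
    constructor
    · filter_upwards [hkB] with r hr
      have : Integrable (fun s => k s r) μ :=
        not_imp_comm.1 integral_undef (by rw [hr]; exact hBpos.ne')
      exact (this.mul_const (x r) : Integrable (fun s => k s r * x r) μ)
    · refine (hxμ.norm.const_mul B).congr ?_
      filter_upwards [hkB] with r hr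
      simp only [Function.uncurry, norm_mul]
      rw [integral_mul_const, ← hr]
      congr 1
      refine integral_congr_ae ?_
      filter_upwards [hknn r] with s hs
      rw [Real.norm_of_nonneg hs]
  have hswap := integral_integral_swap hint
  rw [intervalIntegral.integral_of_le ht, intervalIntegral.integral_of_le ht]
  calc ∫ s in Ioc 0 t, (t - s) ^ (-α) * ∫ r in (0 : ℝ)..s, (s - r) ^ (α - 1) * x r
      = ∫ s, ∫ r, k s r * x r ∂μ ∂μ := by
        refine setIntegral_congr_fun measurableSet_Ioc fun s hs => ?_
        rw [intervalIntegral.integral_of_le hs.1.le, ← integral_const_mul]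
        have e : ∀ r, k s r * x r =
            (Iio s).indicator (fun r => (t - s) ^ (-α) * ((s - r) ^ (α - 1) * x r)) r := by
          intro r
          by_cases h : r < s
          · simp [k, h, mul_assoc]
          · simp [k, h]
        simp only [e]
        rw [integral_indicator measurableSet_Iio, hμ, Measure.restrict_restrict measurableSet_Iio,
          integral_Ioc_eq_integral_Ioo]
        congr 2
        ext r
        simp only [mem_inter_iff, mem_Iio, mem_Ioc, mem_Ioo]
        exact ⟨fun h => ⟨h.2, h.1, h.2.le.trans hs.2⟩, fun h => ⟨h.2.1, h.1⟩⟩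
    _ = ∫ r, ∫ s, k s r * x r ∂μ ∂μ := hswap
    _ = B * ∫ r in Ioc 0 t, x r := by
        rw [← integral_const_mul]
        refine integral_congr_ae ?_
        filter_upwards [hkB] with r hr
        rw [integral_mul_const, hr]

theorem rlIntegral_rlIntegral {α t : ℝ} (h0 : 0 < α) (h1 : α < 1) (ht : 0 ≤ t)
    {x : ℝ → ℝ} (hx : IntervalIntegrable x volume 0 t) :
    rlIntegral (1 - α) (rlIntegral α x) t = ∫ s in (0 : ℝ)..t, x s := by
  have hΓ := Real.Gamma_pos_of_pos h0
  have hΓ' := Real.Gamma_pos_of_pos (sub_pos.2 h1)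
  rw [rlIntegral_of_ne (sub_pos.2 h1).ne']
  have e : ∀ s, (t - s) ^ (1 - α - 1) * rlIntegral α x s = 1 / Real.Gamma α *
      ((t - s) ^ (-α) * ∫ r in (0 : ℝ)..s, (s - r) ^ (α - 1) * x r) := by
    intro s
    rw [rlIntegral_of_ne h0.ne', sub_sub_cancel_left]; ring
  simp only [e]
  rw [intervalIntegral.integral_const_mul, integral_integral_beta_kernel h0 h1 ht hx]
  field_simp

theorem rlIntegral_compl_rlIntegral {α t : ℝ} (h0 : 0 < α) (h1 : α ≤ 1) (ht : 0 ≤ t)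
    {x : ℝ → ℝ} (hx : IntervalIntegrable x volume 0 t) :
    rlIntegral (1 - α) (rlIntegral α x) t = ∫ s in (0 : ℝ)..t, x s := by
  rcases h1.eq_or_lt with rfl | h1
  · rw [sub_self, rlIntegral_zero, rlIntegral_one]
  · exact rlIntegral_rlIntegral h0 h1 ht hx

theorem rlIntegral_rlIntegral_compl {α t : ℝ} (h0 : 0 < α) (h1 : α ≤ 1) (ht : 0 ≤ t)
    {x : ℝ → ℝ} (hx : IntervalIntegrable x volume 0 t) :
    rlIntegral α (rlIntegral (1 - α) x) t = ∫ s in (0 : ℝ)..t, x s := by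
  rcases h1.eq_or_lt with rfl | h1
  · rw [sub_self, rlIntegral_one]; simp only [rlIntegral_zero]
  · have := rlIntegral_rlIntegral (sub_pos.2 h1) (by linarith) ht hx
    rwa [sub_sub_cancel] at this

theorem rlIntegral_sub_of_continuousOn {β t : ℝ} (hβ : 0 ≤ β) {x y : ℝ → ℝ}
    (hx : ContinuousOn x (uIcc 0 t)) (hy : ContinuousOn y (uIcc 0 t)) :
    rlIntegral β (fun s => x s - y s) t = rlIntegral β x t - rlIntegral β y t := by
  rcases hβ.eq_or_lt with rfl | hβ
  · simp only [rlIntegral_zero]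
  simp only [rlIntegral_of_ne hβ.ne', mul_sub]
  rw [intervalIntegral.integral_sub (intervalIntegrable_sub_rpow_mul hβ t hx)
    (intervalIntegrable_sub_rpow_mul hβ t hy), mul_sub]

theorem rlIntegral_sub {β t : ℝ} (hβ : 0 ≤ β) {x y : ℝ → ℝ} (hx : Continuous x)
    (hy : Continuous y) :
    rlIntegral β (fun s => x s - y s) t = rlIntegral β x t - rlIntegral β y t :=
  rlIntegral_sub_of_continuousOn hβ hx.continuousOn hy.continuousOn

theorem rlIntegral_neg (β t : ℝ) (x : ℝ → ℝ) :
    rlIntegral β (fun s => -x s) t = -rlIntegral β x t := by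
  unfold rlIntegral
  split_ifs <;> simp

theorem rlIntegral_const {β t : ℝ} (hβ : 0 < β) (c : ℝ) :
    rlIntegral β (fun _ => c) t = 1 / Real.Gamma β * (c * (t ^ β / β)) := by
  rw [rlIntegral_of_ne hβ.ne', intervalIntegral.integral_mul_const, integral_sub_rpow hβ]
  simp [mul_comm]

/-! ### Equivalence of the Caputo problem with a Volterra equation. -/

theorem eq_zero_of_integral_eq_zero {b : ℝ} {z : ℝ → ℝ} (hz : Continuous z)
    (h : ∀ t ∈ Icc 0 b, ∫ s in (0 : ℝ)..t, z s = 0) (hb : 0 < b) : ∀ t ∈ Icc 0 b, z t = 0 := by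
  have h1 : EqOn z (fun _ => 0) (Ioo 0 b) := by
    intro t ht
    have hd : HasDerivAt (fun t => ∫ s in (0 : ℝ)..t, z s) (z t) t :=
      intervalIntegral.integral_hasDerivAt_right (hz.intervalIntegrable _ _)
        (hz.stronglyMeasurableAtFilter _ _) hz.continuousAt
    have he : (fun t => ∫ s in (0 : ℝ)..t, z s) =ᶠ[𝓝 t] fun _ => 0 := by
      filter_upwards [Ioo_mem_nhds ht.1 ht.2] with s hs
      exact h s ⟨hs.1.le, hs.2.le⟩
    exact hd.unique ((hasDerivAt_const t (0 : ℝ)).congr_of_eventuallyEq he)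
  have h2 := h1.closure hz continuous_const
  rwa [closure_Ioo hb.ne] at h2

/-- Integrating the equation gives `I^(1-α) (u - u 0) = I^1 k = I^(1-α) (I^α k)`. So `I^(1-α)` kills
the difference of `u - u 0` and `I^α k`; applying `I^α` shows that its primitive vanishes, hence so
does the difference. -/
theorem eq_add_rlIntegral_of_hasCaputoDerivAt {α b : ℝ} (h0 : 0 < α) (h1 : α ≤ 1)
    -- The data are only continuous on `[0, b]`; the proof replaces them by constant extensions to
    -- the line, which change no integral over `[0, t]`.
    {u k : ℝ → ℝ} (hu : ContinuousOn u (Icc 0 b)) (hk : ContinuousOn k (Icc 0 b))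
    (h : ∀ t ∈ Ioo 0 b, HasCaputoDerivAt α u (k t) t) (hb : 0 < b) :
    ∀ t ∈ Icc 0 b, u t = u 0 + rlIntegral α k t := by
  have h1' : 0 ≤ 1 - α := sub_nonneg.2 h1
  set u' : ℝ → ℝ := IccExtend hb.le ((Icc 0 b).domRestrict u) with hu'
  set k' : ℝ → ℝ := IccExtend hb.le ((Icc 0 b).domRestrict k) with hk'
  have cu : Continuous u' := (continuousOn_iff_continuous_domRestrict.1 hu).Icc_extend'
  have ck : Continuous k' := (continuousOn_iff_continuous_domRestrict.1 hk).Icc_extend'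
  have eu : ∀ t ∈ Icc 0 b, u' t = u t := fun t ht => IccExtend_of_mem hb.le _ ht
  have ek : ∀ t ∈ Icc 0 b, k' t = k t := fun t ht => IccExtend_of_mem hb.le _ ht
  have eu0 : u' 0 = u 0 := eu 0 ⟨le_rfl, hb.le⟩
  set y : ℝ → ℝ := fun s => u' s - u' 0 with hy
  have cy : Continuous y := cu.sub continuous_const
  have hG : ∀ t ∈ Icc 0 b, rlIntegral (1 - α) y t = ∫ s in (0 : ℝ)..t, k' s := by
    intro t ht
    have cG := continuous_rlIntegral h1' cy
    have hftc := intervalIntegral.integral_eq_sub_of_hasDerivAt_of_le ht.1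
      (f := fun t => rlIntegral (1 - α) y (max t 0)) (f' := k') cG.continuousOn ?_
      (ck.intervalIntegrable _ _)
    · rw [hftc, max_eq_left ht.1, max_self]
      have : rlIntegral (1 - α) y 0 = 0 := by
        rcases h1'.eq_or_lt with e | h1'
        · rw [← e, rlIntegral_zero]; simp [hy]
        · exact rlIntegral_at_zero h1' y
      rw [this, sub_zero]
    · intro s hs
      have hs' : s ∈ Ioo 0 b := ⟨hs.1, hs.2.trans_le ht.2⟩
      rw [ek s ⟨hs'.1.le, hs'.2.le⟩]
      refine (h s hs').congr_of_eventuallyEq ?_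
      filter_upwards [Ioo_mem_nhds hs'.1 hs'.2] with r hr
      rw [max_eq_left hr.1.le]
      refine rlIntegral_congr hr.1.le fun q hq => ?_
      simp only [hy, eu0, eu q ⟨hq.1, hq.2.trans hr.2.le⟩]
  set w : ℝ → ℝ := fun t => rlIntegral α k' (max t 0) with hw
  have cw : Continuous w := continuous_rlIntegral h0.le ck
  have cz : Continuous fun t => y t - w t := cy.sub cw
  have hz : ∀ t ∈ Icc 0 b, y t - w t = 0 := by
    refine eq_zero_of_integral_eq_zero cz (fun t ht => ?_) hb
    rw [← rlIntegral_rlIntegral_compl h0 h1 ht.1 (cz.intervalIntegrable _ _),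
      rlIntegral_congr (y := fun _ => 0) ht.1 fun s hs => ?_, rlIntegral_const h0]
    · simp
    · change rlIntegral (1 - α) (fun s => y s - w s) s = 0
      rw [rlIntegral_sub h1' cy cw, hG s ⟨hs.1, hs.2.trans ht.2⟩,
        rlIntegral_congr (y := rlIntegral α k') hs.1 fun r hr => ?_,
        rlIntegral_compl_rlIntegral h0 h1 hs.1 (ck.intervalIntegrable _ _), sub_self]
      simp only [hw, max_eq_left hr.1]
  intro t ht
  have e := hz t ht
  simp only [hy, hw, eu0, eu t ht, max_eq_left ht.1] at e
  rw [rlIntegral_congr (y := k) ht.1 fun s hs => ek s ⟨hs.1, hs.2.trans ht.2⟩] at e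
  linarith

theorem hasCaputoDerivAt_of_eq_add_rlIntegral {α c : ℝ} (h0 : 0 < α) (h1 : α ≤ 1)
    {u k : ℝ → ℝ} (hk : Continuous k) (hu : ∀ t, 0 ≤ t → u t = c + rlIntegral α k t)
    {t : ℝ} (ht : 0 < t) : HasCaputoDerivAt α u (k t) t := by
  have hd : HasDerivAt (fun t => ∫ s in (0 : ℝ)..t, k s) (k t) t :=
    intervalIntegral.integral_hasDerivAt_right (hk.intervalIntegrable _ _)
      (hk.stronglyMeasurableAtFilter _ _) hk.continuousAt
  refine hd.congr_of_eventuallyEq ?_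
  filter_upwards [Ioi_mem_nhds ht] with s hs
  have hs : 0 < s := hs
  rw [← rlIntegral_compl_rlIntegral h0 h1 hs.le (hk.intervalIntegrable _ _)]
  refine rlIntegral_congr hs.le fun r hr => ?_
  rw [hu r hr.1, hu 0 le_rfl, rlIntegral_at_zero h0]
  ring

/-! ### A minimum principle for fractional integral equations. -/

theorem abs_rpow_sub_rpow_le {γ η x y : ℝ} (hγ : γ ≤ 1) (hη : 0 < η) (hx : η ≤ x) (hy : η ≤ y) :
    |y ^ γ - x ^ γ| ≤ |γ| * η ^ (γ - 1) * |y - x| := by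
  refine Convex.norm_image_sub_le_of_norm_hasDerivWithin_le (s := Ici η)
    (f := fun x => x ^ γ) (f' := fun x => γ * x ^ (γ - 1)) (fun z hz => ?_) (fun z hz => ?_)
    (convex_Ici η) hx hy
  · exact (Real.hasDerivAt_rpow_const (Or.inl (hη.trans_le hz).ne')).hasDerivWithinAt
  · rw [norm_mul, Real.norm_eq_abs, Real.norm_of_nonneg (Real.rpow_nonneg (hη.trans_le hz).le _)]
    exact mul_le_mul_of_nonneg_left (Real.rpow_le_rpow_of_nonpos hη hz (by linarith))
      (abs_nonneg _)

/-- Compare the integral at `t₁` and at `t₁ - ε`. The kernel decreases in `t` and `U - m ≥ 0`, so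
the part over `[0, t₁ - ε]` does not grow; by the Lipschitz bound the rest is at most `L * ε ^ (β +
1)`. The right-hand side of `hW` grows by at least `D * t₁ ^ (β - 1) * ε`, which is impossible as `ε
→ 0`. -/
theorem no_lipschitz_minimum {β a t₁ m c₀ D L η : ℝ} (hβ : 0 < β) (hβ1 : β < 1)
    (hη : 0 < η) (haη : a ≤ t₁ - η) (ha : 0 ≤ a) (hD : 0 < D) {U : ℝ → ℝ} (hU : Continuous U)
    (hmin : ∀ s ∈ Icc 0 t₁, m ≤ U s)
    (hL : ∀ s ∈ Icc (t₁ - η) t₁, U s - m ≤ L * (t₁ - s))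
    (hW : ∀ t ∈ Icc a t₁,
      ∫ s in (0 : ℝ)..t, (t - s) ^ (β - 1) * (U s - m) = c₀ + D * (t ^ β / β)) : False := by
  have ht₁ : 0 < t₁ := by linarith
  have hL0 : 0 ≤ L := by
    have h1 := hmin (t₁ - η) ⟨by linarith, by linarith⟩
    have h2 := hL (t₁ - η) ⟨le_rfl, by linarith⟩
    nlinarith
  have cU : Continuous fun s => U s - m := hU.sub continuous_const
  have key : ∀ ε ∈ Ioc 0 η, D * t₁ ^ (β - 1) ≤ L * ε ^ β := by
    intro ε hε
    set τ := t₁ - ε with hτ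
    have hτa : a ≤ τ := by linarith [hε.2]
    have hτ0 : 0 ≤ τ := ha.trans hτa
    have hτt : τ < t₁ := by linarith [hε.1]
    have i1 : ∀ t x y : ℝ, IntervalIntegrable (fun s => (t - s) ^ (β - 1) * (U s - m)) volume x y :=
      fun t x y => intervalIntegrable_sub_rpow_mul hβ t cU.continuousOn
    have h1 : ∫ s in (0 : ℝ)..τ, (t₁ - s) ^ (β - 1) * (U s - m) ≤
        ∫ s in (0 : ℝ)..τ, (τ - s) ^ (β - 1) * (U s - m) := by
      refine intervalIntegral.integral_mono_on_of_le_Ioo hτ0 (i1 _ _ _) (i1 _ _ _) fun s hs => ?_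
      refine mul_le_mul_of_nonneg_right ?_
        (sub_nonneg.2 (hmin s ⟨hs.1.le, (hs.2.trans hτt).le⟩))
      exact Real.rpow_le_rpow_of_nonpos (sub_pos.2 hs.2) (by linarith) (by linarith)
    have h2 : ∫ s in τ..t₁, (t₁ - s) ^ (β - 1) * (U s - m) ≤ L * ε ^ β * ε := by
      have h3 : ∫ s in τ..t₁, (t₁ - s) ^ (β - 1) * (U s - m) ≤ ∫ s in τ..t₁, L * ε ^ β := by
        refine intervalIntegral.integral_mono_on_of_le_Ioo hτt.le (i1 _ _ _)
          intervalIntegrable_const fun s hs => ?_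
        have hs0 : 0 < t₁ - s := sub_pos.2 hs.2
        calc (t₁ - s) ^ (β - 1) * (U s - m) ≤ (t₁ - s) ^ (β - 1) * (L * (t₁ - s)) :=
              mul_le_mul_of_nonneg_left (hL s ⟨by linarith [hs.1, hε.2], hs.2.le⟩)
                (Real.rpow_nonneg hs0.le _)
          _ = L * (t₁ - s) ^ β := by
              rw [Real.rpow_sub_one hs0.ne']; field_simp
          _ ≤ L * ε ^ β := mul_le_mul_of_nonneg_left
              (Real.rpow_le_rpow hs0.le (by linarith [hs.1]) hβ.le) hL0
      rw [intervalIntegral.integral_const, smul_eq_mul] at h3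
      calc _ ≤ _ := h3
        _ = _ := by rw [hτ]; ring
    have h4 := intervalIntegral.integral_add_adjacent_intervals (i1 t₁ 0 τ) (i1 t₁ τ t₁)
    rw [hW t₁ ⟨hτa.trans hτt.le, le_rfl⟩] at h4
    rw [hW τ ⟨hτa, hτt.le⟩] at h1
    -- Concavity of the power (Bernoulli): the graph lies below its tangent at `t₁`.
    have h5 : τ ^ β ≤ t₁ ^ β - β * t₁ ^ (β - 1) * ε := by
      have hb := rpow_one_add_le_one_add_mul_self (s := -(ε / t₁)) (p := β)
        (by rw [neg_le_neg_iff, div_le_one ht₁]; linarith) hβ.le hβ1.le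
      have e1 : τ = t₁ * (1 + -(ε / t₁)) := by field_simp; linarith
      rw [e1, Real.mul_rpow ht₁.le (by
        have : ε / t₁ ≤ 1 := by rw [div_le_one ht₁]; linarith
        linarith)]
      calc _ ≤ t₁ ^ β * (1 + β * -(ε / t₁)) :=
            mul_le_mul_of_nonneg_left hb (Real.rpow_nonneg ht₁.le _)
        _ = _ := by rw [Real.rpow_sub_one ht₁.ne']; field_simp; ring
    have h6 : t₁ ^ (β - 1) * ε ≤ t₁ ^ β / β - τ ^ β / β := by
      rw [← sub_div, le_div_iff₀ hβ]; linarith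
    have h7 : D * (t₁ ^ (β - 1) * ε) ≤ D * (t₁ ^ β / β - τ ^ β / β) :=
      mul_le_mul_of_nonneg_left h6 hD.le
    have h8 : D * t₁ ^ (β - 1) * ε ≤ L * ε ^ β * ε := by linarith
    exact le_of_mul_le_mul_right h8 hε.1
  have hlim : Tendsto (fun ε : ℝ => L * ε ^ β) (𝓝[>] 0) (𝓝 (L * 0 ^ β)) :=
    ((continuous_const.mul (Real.continuous_rpow_const hβ.le)).tendsto 0).mono_left
      nhdsWithin_le_nhds
  rw [Real.zero_rpow hβ.ne', mul_zero] at hlim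
  have hge : D * t₁ ^ (β - 1) ≤ 0 := by
    refine ge_of_tendsto hlim ?_
    filter_upwards [Ioc_mem_nhdsGT hη] with ε hε using key ε hε
  exact absurd hge (not_le.2 (mul_pos hD (Real.rpow_pos_of_pos ht₁ _)))

/-- The fractional integral of the forcing on `[a, t]` is a shifted fractional integral. -/
theorem rlIntegral_shift {α a t : ℝ} (h0 : 0 < α) (h : ℝ → ℝ) :
    rlIntegral α (fun r => h (r + a)) (t - a) =
      1 / Real.Gamma α * ∫ r in a..t, (t - r) ^ (α - 1) * h r := by
  rw [rlIntegral_of_ne h0.ne']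
  have e := intervalIntegral.integral_comp_add_right (a := 0) (b := t - a)
    (fun r => (t - r) ^ (α - 1) * h r) a
  rw [zero_add, sub_add_cancel] at e
  rw [← e]
  congr 1
  refine intervalIntegral.integral_congr fun r _ => ?_
  simp only [sub_sub, add_comm]

theorem rlIntegral_indicator {α a t : ℝ} (h0 : 0 < α) (ht : 0 ≤ t) (ha : 0 ≤ a) (h : ℝ → ℝ) :
    rlIntegral α ((Iic a).indicator h) t =
      1 / Real.Gamma α * ∫ r in (0 : ℝ)..(min t a), (t - r) ^ (α - 1) * h r := by
  rw [rlIntegral_of_ne h0.ne', intervalIntegral.integral_of_le ht,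
    intervalIntegral.integral_of_le (le_min ht ha)]
  congr 1
  have e : (fun s => (t - s) ^ (α - 1) * (Iic a).indicator h s) =
      (Iic a).indicator fun s => (t - s) ^ (α - 1) * h s := by
    ext s; by_cases hs : s ≤ a <;> simp [hs]
  rw [e, setIntegral_indicator measurableSet_Iic, Ioc_inter_Iic]

/-- With `h` merely continuous, `u` need not be Lipschitz at `t₁`, so the usual estimate at an
extremum is not available for `u`. If `h > 0` on `[a, t₁]`, remove the contribution `V` of the
forcing after time `a`. The remainder `U` lies below `u t₁` somewhere, its minimum falls after `a`,
and there it is Lipschitz, since its forcing stops at `a`. Moreover `I^(1-α) (U - u₀)` is constant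
after `a`, which contradicts `no_lipschitz_minimum`. -/
theorem not_pos_at_strict_minimum {α u₀ t₁ : ℝ} (h0 : 0 < α) (h1 : α ≤ 1) {h u : ℝ → ℝ}
    (hh : Continuous h) (cu : Continuous u) (hu : ∀ t ∈ Icc 0 t₁, u t = u₀ + rlIntegral α h t)
    (ht₁ : 0 < t₁) (hlt : u t₁ < u₀) (hmin : ∀ s ∈ Icc 0 t₁, u t₁ ≤ u s) : h t₁ ≤ 0 := by
  by_contra! hpos
  have hΓ := Real.Gamma_pos_of_pos h0
  obtain ⟨a, ha0, hat, ha⟩ : ∃ a, 0 ≤ a ∧ a < t₁ ∧ ∀ s ∈ Icc a t₁, 0 < h s := by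
    obtain ⟨ε, hε, hb⟩ := Metric.eventually_nhds_iff.1
      ((hh.tendsto t₁).eventually (lt_mem_nhds hpos))
    refine ⟨max 0 (t₁ - ε / 2), le_max_left _ _, max_lt ht₁ (by linarith), fun s hs => hb ?_⟩
    rw [Real.dist_eq, abs_lt]
    have := (le_max_right _ _).trans hs.1
    exact ⟨by linarith, by linarith [hs.2]⟩
  have hint : ∀ t x y : ℝ, IntervalIntegrable (fun r => (t - r) ^ (α - 1) * h r) volume x y :=
    fun t x y => intervalIntegrable_sub_rpow_mul h0 t hh.continuousOn
  set V : ℝ → ℝ := fun t => rlIntegral α (fun r => h (r + a)) (max (t - a) 0) with hV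
  have cV : Continuous V :=
    (continuous_rlIntegral h0.le (x := fun r => h (r + a)) (by fun_prop)).comp
      (by fun_prop : Continuous fun t : ℝ => t - a)
  have V0 : ∀ t ≤ a, V t = 0 := by
    intro t ht
    simp only [hV, max_eq_right (sub_nonpos.2 ht), rlIntegral_at_zero h0]
  have V1 : ∀ t, a ≤ t → V t = 1 / Real.Gamma α * ∫ r in a..t, (t - r) ^ (α - 1) * h r := by
    intro t ht
    simp only [hV, max_eq_left (sub_nonneg.2 ht), rlIntegral_shift h0]
  have Vpos : 0 < V t₁ := by
    rw [V1 t₁ hat.le]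
    refine mul_pos (by positivity) ?_
    refine intervalIntegral.intervalIntegral_pos_of_pos_on (hint _ _ _) (fun s hs => ?_) hat
    exact mul_pos (Real.rpow_pos_of_pos (sub_pos.2 hs.2) _) (ha s ⟨hs.1.le, hs.2.le⟩)
  set U : ℝ → ℝ := fun t => u t - V t with hU
  have cU : Continuous U := cu.sub cV
  have U1 : ∀ t ∈ Icc a t₁,
      U t = u₀ + 1 / Real.Gamma α * ∫ r in (0 : ℝ)..a, (t - r) ^ (α - 1) * h r := by
    intro t ht
    simp only [hU]
    rw [hu t ⟨ha0.trans ht.1, ht.2⟩, V1 t ht.1, rlIntegral_of_ne h0.ne',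
      ← intervalIntegral.integral_add_adjacent_intervals (hint t 0 a) (hint t a t)]
    ring
  have U2 : ∀ t ∈ Icc 0 t₁, U t - u₀ = rlIntegral α ((Iic a).indicator h) t := by
    intro t ht
    rw [rlIntegral_indicator h0 ht.1 ha0]
    rcases le_total t a with h' | h'
    · simp only [hU, V0 t h', min_eq_left h', hu t ht, rlIntegral_of_ne h0.ne']; ring
    · rw [U1 t ⟨h', ht.2⟩, min_eq_right h']; ring
  obtain ⟨t', ht', hmin'⟩ := isCompact_Icc.exists_isMinOn
    (nonempty_Icc.2 ht₁.le) (cU.continuousOn (s := Icc 0 t₁))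
  have hmin' : ∀ s ∈ Icc 0 t₁, U t' ≤ U s := fun s hs => hmin' hs
  have hUt' : U t' < u t₁ := (hmin' t₁ ⟨ht₁.le, le_rfl⟩).trans_lt (by simp only [hU]; linarith)
  -- Up to time `a` the functions `U` and `u` agree, and `u` is nowhere below `u t₁`.
  have hat' : a < t' := by
    by_contra! hle
    have := hmin t' ht'
    have e : U t' = u t' := by simp only [hU, V0 t' hle, sub_zero]
    linarith
  -- For `α = 1` the kernel is `1`, so `U` is constant after `a` and its minimum would already be
  -- attained at `a`.
  rcases h1.eq_or_lt with rfl | h1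
  · have e : U t' = U a := by
      rw [U1 t' ⟨hat'.le, ht'.2⟩, U1 a ⟨le_rfl, hat.le⟩]; simp
    have e' : U a = u a := by simp only [hU, V0 a le_rfl, sub_zero]
    have := hmin a ⟨ha0, hat.le⟩
    linarith
  obtain ⟨M, hM⟩ := (isCompact_Icc (a := 0) (b := a)).exists_bound_of_continuousOn
    hh.continuousOn
  have hM0 : 0 ≤ M := (norm_nonneg _).trans (hM 0 ⟨le_rfl, ha0⟩)
  set η := (t' - a) / 2 with hη
  have hηpos : 0 < η := by simp only [hη]; linarith
  have hd : 0 < u₀ - U t' := by linarith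
  -- For `s ≥ a + η` and `r ≤ a` the kernel stays at distance `η` from its singularity: `L` is its
  -- Lipschitz constant there, times the bound `M` of `h` and the length `a`.
  set L := 1 / Real.Gamma α * (|α - 1| * η ^ (α - 1 - 1) * M * a) with hLdef
  refine no_lipschitz_minimum (β := 1 - α) (a := a) (t₁ := t') (m := U t')
    (c₀ := Real.Gamma (1 - α) * ∫ s in (0 : ℝ)..a, h s) (D := u₀ - U t') (L := L) (η := η)
    (by linarith) (by linarith) hηpos (by linarith) ha0 hd cU
    (fun s hs => hmin' s ⟨hs.1, hs.2.trans ht'.2⟩) (fun s hs => ?_) (fun t ht => ?_)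
  · have hsa : a + η ≤ s := by linarith [hs.1]
    rw [U1 s ⟨by linarith, hs.2.trans ht'.2⟩, U1 t' ⟨hat'.le, ht'.2⟩, add_sub_add_left_eq_sub,
      ← mul_sub, ← intervalIntegral.integral_sub (hint _ _ _) (hint _ _ _), hLdef, mul_assoc]
    refine mul_le_mul_of_nonneg_left ?_ (by positivity)
    refine (le_abs_self _).trans ?_
    rw [← Real.norm_eq_abs]
    refine (intervalIntegral.norm_integral_le_of_norm_le_const
      (C := |α - 1| * η ^ (α - 1 - 1) * (t' - s) * M) fun r hr => ?_).trans_eq ?_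
    · rw [uIoc_of_le ha0] at hr
      rw [← sub_mul, norm_mul]
      refine mul_le_mul ?_ (hM r ⟨hr.1.le, hr.2⟩) (norm_nonneg _) ?_
      · have := abs_rpow_sub_rpow_le (γ := α - 1) (η := η) (x := t' - r) (y := s - r)
          (by linarith) hηpos (by linarith [hr.2, hs.2]) (by linarith [hr.2])
        rw [Real.norm_eq_abs]
        refine this.trans_eq ?_
        rw [sub_sub_sub_cancel_right, abs_sub_comm s, abs_of_nonneg (sub_nonneg.2 hs.2)]
      · have := hs.2
        have : 0 ≤ t' - s := by linarith
        positivity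
    · rw [sub_zero, abs_of_nonneg ha0]; ring
  · have ht0 : 0 ≤ t := ha0.trans ht.1
    have ht₁' : t ≤ t₁ := ht.2.trans ht'.2
    have hβ : 0 < 1 - α := by linarith
    have hΓ' := Real.Gamma_pos_of_pos hβ
    have hind : IntervalIntegrable ((Iic a).indicator h) volume 0 t :=
      ⟨(hh.intervalIntegrable 0 t).1.indicator measurableSet_Iic,
        (hh.intervalIntegrable 0 t).2.indicator measurableSet_Iic⟩
    have e1 : rlIntegral (1 - α) (fun s => U s - u₀) t = ∫ s in (0 : ℝ)..a, h s := by
      rw [rlIntegral_congr (y := rlIntegral α ((Iic a).indicator h)) ht0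
        fun s hs => U2 s ⟨hs.1, hs.2.trans ht₁'⟩, rlIntegral_rlIntegral h0 h1 ht0 hind,
        intervalIntegral.integral_of_le ht0, intervalIntegral.integral_of_le ha0,
        setIntegral_indicator measurableSet_Iic, Ioc_inter_Iic, min_eq_right ht.1]
    have e2 := rlIntegral_sub (β := 1 - α) (t := t) hβ.le (cU.sub continuous_const)
      (continuous_const (y := U t' - u₀))  (x := fun s => U s - u₀)
    simp only [sub_sub_sub_cancel_right] at e2
    rw [e1, rlIntegral_const hβ, rlIntegral_of_ne hβ.ne'] at e2
    field_simp at e2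
    field_simp
    linarith

/-- A negative minimum would lie strictly below `u₀ ≥ 0`, hence at a positive time, where the
minimum principle contradicts `hpos`. -/
theorem nonneg_of_eq_add_rlIntegral {α u₀ b : ℝ} (h0 : 0 < α) (h1 : α ≤ 1) {h u : ℝ → ℝ}
    (hh : Continuous h) (cu : Continuous u) (hu : ∀ t ∈ Icc 0 b, u t = u₀ + rlIntegral α h t)
    (hu₀ : 0 ≤ u₀) (hpos : ∀ t ∈ Icc 0 b, u t < 0 → 0 < h t) : ∀ t ∈ Icc 0 b, 0 ≤ u t := by
  by_contra! hcon
  obtain ⟨s, hs, hneg⟩ := hcon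
  obtain ⟨t₁, ht₁, hmin⟩ := isCompact_Icc.exists_isMinOn
    (nonempty_Icc.2 (hs.1.trans hs.2)) (cu.continuousOn (s := Icc 0 b))
  have hm : u t₁ < 0 := lt_of_le_of_lt (hmin hs) hneg
  have hne : 0 < t₁ := by
    refine lt_of_le_of_ne ht₁.1 fun e => ?_
    have := hu t₁ ht₁
    rw [← e, rlIntegral_at_zero h0, add_zero] at this
    rw [← e] at hm
    linarith
  exact absurd (not_pos_at_strict_minimum h0 h1 hh cu
    (fun t ht => hu t ⟨ht.1, ht.2.trans ht₁.2⟩) hne (hm.trans_le hu₀)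
    fun r hr => hmin ⟨hr.1, hr.2.trans ht₁.2⟩) (not_le.2 (hpos t₁ ht₁ hm))

/-! ### Homogeneous and cooperative vector fields. -/

theorem IsHomogeneous.map_zero {d : ℕ} {p : ℝ} {f : (Fin d → ℝ) → (Fin d → ℝ)}
    (hf : IsHomogeneous p f) (hp : 1 ≤ p) : f 0 = 0 := by
  have h := hf 0 2 (by norm_num)
  rw [smul_zero] at h
  have h2 : (2 : ℝ) ^ p ≠ 1 := (Real.one_lt_rpow (by norm_num) (by linarith)).ne'
  have h3 : ((2 : ℝ) ^ p - 1) • f 0 = 0 := by rw [sub_smul, one_smul, ← h, sub_self]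
  exact (smul_eq_zero.1 h3).resolve_left (sub_ne_zero.2 h2)

theorem IsHomogeneous.map_smul_of_nonneg {d : ℕ} {p : ℝ} {f : (Fin d → ℝ) → (Fin d → ℝ)}
    (hf : IsHomogeneous p f) (hp : 1 ≤ p) {c : ℝ} (hc : 0 ≤ c) (x : Fin d → ℝ) :
    f (c • x) = c ^ p • f x := by
  rcases hc.eq_or_lt with rfl | hc
  · rw [zero_smul, hf.map_zero hp, Real.zero_rpow (by linarith), zero_smul]
  · exact hf x c hc

theorem differentiableAt_of_contDiffOn_compl_zero {d : ℕ} {f : (Fin d → ℝ) → (Fin d → ℝ)}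
    (hf : ContDiffOn ℝ 1 f {0}ᶜ) {x : Fin d → ℝ} (hx : x ≠ 0) : DifferentiableAt ℝ f x :=
  (hf.contDiffAt (isOpen_compl_singleton.mem_nhds hx)).differentiableAt one_ne_zero

theorem IsHomogeneous.fderiv_smul {d : ℕ} {p : ℝ} {f : (Fin d → ℝ) → (Fin d → ℝ)}
    (hf : IsHomogeneous p f) (hfd : ContDiffOn ℝ 1 f {0}ᶜ) {c : ℝ} (hc : 0 < c)
    {x : Fin d → ℝ} (hx : x ≠ 0) : fderiv ℝ f (c • x) = c ^ (p - 1) • fderiv ℝ f x := by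
  have h1 : (fun y => f (c • y)) = fun y => c ^ p • f y := funext fun y => hf y c hc
  have h2 := fderiv_comp_smul (f := f) (x := x) c
  rw [h1, fderiv_fun_const_smul (differentiableAt_of_contDiffOn_compl_zero hfd hx)] at h2
  rw [Real.rpow_sub_one hc.ne', div_eq_inv_mul, ← smul_smul, h2, smul_smul,
    inv_mul_cancel₀ hc.ne', one_smul]

/-- The derivative is homogeneous of degree `p - 1 ≥ 0`, so its bound on the unit sphere controls it
on the punctured ball, and the mean value inequality covers segments that avoid the origin. On a
segment through the origin, `‖x - y‖ = ‖x‖ + ‖y‖`, and the growth bound `‖f x‖ ≤ L * ‖x‖` suffices.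
-/
theorem IsHomogeneous.exists_lipschitz {d : ℕ} {p : ℝ} {f : (Fin d → ℝ) → (Fin d → ℝ)}
    (hf : IsHomogeneous p f) (hp : 1 ≤ p) (hfc : Continuous f) (hfd : ContDiffOn ℝ 1 f {0}ᶜ)
    {R : ℝ} (hR : 0 ≤ R) :
    ∃ L, 0 ≤ L ∧ ∀ x y, ‖x‖ ≤ R → ‖y‖ ≤ R → ‖f x - f y‖ ≤ L * ‖x - y‖ := by
  have hsub : Metric.sphere (0 : Fin d → ℝ) 1 ⊆ {0}ᶜ := fun x hx h => by
    rw [mem_sphere_zero_iff_norm, mem_singleton_iff.1 h] at hx; simp at hx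
  obtain ⟨M₁, hM₁⟩ := (isCompact_sphere (0 : Fin d → ℝ) 1).exists_bound_of_continuousOn
    hfc.continuousOn
  obtain ⟨M₂, hM₂⟩ := (isCompact_sphere (0 : Fin d → ℝ) 1).exists_bound_of_continuousOn
    ((hfd.continuousOn_fderiv_of_isOpen isOpen_compl_singleton le_rfl).mono hsub)
  -- The `0` guards against the empty sphere when `d = 0`.
  set M := max 0 (max M₁ M₂) with hM
  have hM0 : 0 ≤ M := le_max_left _ _
  have hdir : ∀ x : Fin d → ℝ, x ≠ 0 → ∃ e ∈ Metric.sphere (0 : Fin d → ℝ) 1, x = ‖x‖ • e := by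
    intro x hx
    have hx' : ‖x‖ ≠ 0 := norm_ne_zero_iff.2 hx
    refine ⟨‖x‖⁻¹ • x, ?_, ?_⟩
    · rw [mem_sphere_zero_iff_norm, norm_smul, norm_inv, norm_norm, inv_mul_cancel₀ hx']
    · rw [smul_smul, mul_inv_cancel₀ hx', one_smul]
  have hpow : ∀ x : Fin d → ℝ, ‖x‖ ≤ R → ‖x‖ ^ (p - 1) ≤ R ^ (p - 1) := fun x hx =>
    Real.rpow_le_rpow (norm_nonneg _) hx (by linarith)
  set L := R ^ (p - 1) * M with hLdef
  have hL0 : 0 ≤ L := mul_nonneg (Real.rpow_nonneg hR _) hM0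
  have hb₁ : ∀ x : Fin d → ℝ, ‖x‖ ≤ R → ‖f x‖ ≤ L * ‖x‖ := by
    intro x hxR
    by_cases hx : x = 0
    · simp [hx, hf.map_zero hp]
    obtain ⟨e, he, hxe⟩ := hdir x hx
    have hx0 : 0 < ‖x‖ := norm_pos_iff.2 hx
    have h1 : ‖f x‖ = ‖x‖ ^ p * ‖f e‖ := by
      conv_lhs => rw [hxe, hf e _ hx0, norm_smul, Real.norm_of_nonneg (by positivity)]
    have h2 : ‖x‖ ^ p = ‖x‖ ^ (p - 1) * ‖x‖ := by
      rw [Real.rpow_sub_one hx0.ne']; field_simp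
    have h3 : ‖f e‖ ≤ M := (hM₁ e he).trans ((le_max_left _ _).trans (le_max_right _ _))
    rw [h1, h2, hLdef, mul_right_comm]
    exact mul_le_mul_of_nonneg_right
      (mul_le_mul (hpow x hxR) h3 (norm_nonneg _) (Real.rpow_nonneg hR _)) (norm_nonneg _)
  have hb₂ : ∀ x : Fin d → ℝ, x ≠ 0 → ‖x‖ ≤ R → ‖fderiv ℝ f x‖ ≤ L := by
    intro x hx hxR
    obtain ⟨e, he, hxe⟩ := hdir x hx
    have hx0 : 0 < ‖x‖ := norm_pos_iff.2 hx
    have h3 : ‖fderiv ℝ f e‖ ≤ M :=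
      (hM₂ e he).trans ((le_max_right _ _).trans (le_max_right _ _))
    have h1 : ‖fderiv ℝ f x‖ = ‖x‖ ^ (p - 1) * ‖fderiv ℝ f e‖ := by
      conv_lhs => rw [hxe, hf.fderiv_smul hfd hx0 (hsub he), norm_smul,
        Real.norm_of_nonneg (by positivity)]
    rw [h1]
    exact mul_le_mul (hpow x hxR) h3 (norm_nonneg _) (Real.rpow_nonneg hR _)
  refine ⟨L, hL0, fun x y hx hy => ?_⟩
  by_cases h0 : (0 : Fin d → ℝ) ∈ segment ℝ x y
  · have h := dist_add_dist_of_mem_segment h0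
    rw [dist_zero_right, dist_zero_left, dist_eq_norm] at h
    calc ‖f x - f y‖ ≤ ‖f x‖ + ‖f y‖ := norm_sub_le _ _
      _ ≤ L * ‖x‖ + L * ‖y‖ := add_le_add (hb₁ x hx) (hb₁ y hy)
      _ = L * ‖x - y‖ := by rw [← h, mul_add]
  · have hball : segment ℝ x y ⊆ Metric.closedBall 0 R :=
      (convex_closedBall 0 R).segment_subset (mem_closedBall_zero_iff.2 hx)
        (mem_closedBall_zero_iff.2 hy)
    have hne : ∀ z ∈ segment ℝ x y, z ≠ 0 := fun z hz h => h0 (h ▸ hz)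
    exact Convex.norm_image_sub_le_of_norm_fderiv_le (s := segment ℝ x y)
      (fun z hz => differentiableAt_of_contDiffOn_compl_zero hfd (hne z hz))
      (fun z hz => hb₂ z (hne z hz) (mem_closedBall_zero_iff.1 (hball hz)))
      (convex_segment x y) (right_mem_segment ℝ x y) (left_mem_segment ℝ x y)

/-- Along the segment from `x` to `y` the `i`-th component has derivative `∑ k, ∂_k f_i * (y k - x
k)`. The diagonal term drops out because `x i = y i`, and the others are nonnegative. -/
theorem IsCooperative.apply_le_apply {d : ℕ} {f : (Fin d → ℝ) → (Fin d → ℝ)}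
    (hf : IsCooperative f) {x y : Fin d → ℝ} (hx : 0 ≤ x) (hxy : x ≤ y) {i : Fin d}
    (hi : x i = y i) : f x i ≤ f y i := by
  by_cases hy : y = 0
  · rw [le_antisymm hxy (hy ▸ hx)]
  set γ : ℝ → Fin d → ℝ := fun t => x + t • (y - x) with hγ
  have cγ : Continuous γ := by fun_prop
  have hd : ∀ t ∈ Ioo (0 : ℝ) 1,
      HasDerivAt (fun t => f (γ t) i) (fderiv ℝ f (γ t) (y - x) i) t := by
    intro t ht
    have hne : γ t ≠ 0 := by
      intro h
      apply hy
      ext k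
      have hk : x k + t * (y k - x k) = 0 := by simpa [hγ] using congrFun h k
      have h1 : 0 ≤ x k := hx k
      have h2 : x k ≤ y k := hxy k
      have h3 : 0 ≤ t * (y k - x k) := mul_nonneg ht.1.le (by linarith)
      have h4 : t * (y k - x k) = 0 := by linarith
      have h5 : x k = 0 := by linarith
      have h6 := (mul_eq_zero.1 h4).resolve_left ht.1.ne'
      change y k = 0
      linarith
    have h1 : HasDerivAt γ (y - x) t := by
      have h := ((hasDerivAt_id t).smul_const (y - x)).const_add x
      rw [one_smul] at h
      exact h
    have h2 := (differentiableAt_of_contDiffOn_compl_zero hf.contDiffOn hne).hasFDerivAt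
    exact hasDerivAt_pi.1 (h2.comp_hasDerivAt t h1) i
  have hnn : ∀ t ∈ Ioo (0 : ℝ) 1, 0 ≤ fderiv ℝ f (γ t) (y - x) i := by
    intro t ht
    have hγ0 : 0 ≤ γ t := fun k =>
      add_nonneg (hx k) (mul_nonneg ht.1.le (sub_nonneg.2 (hxy k)))
    by_cases hne : γ t = 0
    · have hk : ∀ k, y k - x k = 0 := by
        intro k
        have hk : x k + t * (y k - x k) = 0 := by simpa [hγ] using congrFun hne k
        have h1 : 0 ≤ x k := hx k
        have h3 : 0 ≤ t * (y k - x k) := mul_nonneg ht.1.le (sub_nonneg.2 (hxy k))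
        have h4 : t * (y k - x k) = 0 := by linarith
        exact (mul_eq_zero.1 h4).resolve_left ht.1.ne'
      have : y - x = 0 := funext hk
      simp [this]
    have hsum : y - x = ∑ k, (y k - x k) • (Pi.single k (1 : ℝ) : Fin d → ℝ) := by
      ext l
      simp [Finset.sum_apply, Pi.single_apply]
    rw [hsum, map_sum, Finset.sum_apply]
    refine Finset.sum_nonneg fun k _ => ?_
    rw [map_smul, Pi.smul_apply, smul_eq_mul]
    by_cases hik : i = k
    · rw [← hik, hi, sub_self, zero_mul]
    · exact mul_nonneg (sub_nonneg.2 (hxy k)) (hf.metzler _ hγ0 hne i k hik)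
  have hmono : MonotoneOn (fun t => f (γ t) i) (Icc 0 1) := by
    refine monotoneOn_of_deriv_nonneg (convex_Icc 0 1)
      ((continuous_apply i).comp (hf.continuous.comp cγ)).continuousOn ?_ ?_
    · rw [interior_Icc]
      exact fun t ht => (hd t ht).differentiableAt.differentiableWithinAt
    · rw [interior_Icc]
      intro t ht
      rw [(hd t ht).deriv]
      exact hnn t ht
  have := hmono (left_mem_Icc.2 zero_le_one) (right_mem_Icc.2 zero_le_one) zero_le_one
  simpa [hγ] using this

/-! ### Volterra equations in exponentially weighted norms. -/

theorem exists_weight {d : ℕ} {α : Fin d → ℝ} (hα : ∀ i, 0 < α i) (L : ℝ) :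
    ∃ lam : ℝ, 1 ≤ lam ∧ ∀ i, L * (1 / lam) ^ α i ≤ 1 / 2 := by
  have h : ∀ i, ∀ᶠ lam : ℝ in atTop, L * (1 / lam) ^ α i ≤ 1 / 2 := by
    intro i
    have h1 : Tendsto (fun lam : ℝ => L * (1 / lam) ^ α i) atTop (𝓝 (L * 0 ^ α i)) := by
      simp only [one_div]
      exact (((Real.continuous_rpow_const (hα i).le).tendsto 0).comp
        tendsto_inv_atTop_zero).const_mul L
    rw [Real.zero_rpow (hα i).ne', mul_zero] at h1
    exact (h1.eventually (gt_mem_nhds (by norm_num : (0 : ℝ) < 1 / 2))).mono fun _ h => h.le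
  obtain ⟨lam, h1, h2⟩ := ((eventually_ge_atTop (1 : ℝ)).and (eventually_all.2 h)).exists
  exact ⟨lam, h1, h2⟩

theorem weighted_rlIntegral_le {β lam C : ℝ} (hβ : 0 < β) (hlam : 0 < lam) {x : ℝ → ℝ}
    (hC : 0 ≤ C) (hx : ∀ s, 0 ≤ s → |x s| ≤ C * Real.exp (lam * s)) (t : ℝ) :
    |Real.exp (-(lam * t)) * rlIntegral β x (max t 0)| ≤ C * (1 / lam) ^ β := by
  rcases le_total t 0 with ht | ht
  · rw [max_eq_right ht, rlIntegral_at_zero hβ, mul_zero, abs_zero]; positivity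
  rw [max_eq_left ht, abs_mul, abs_of_pos (Real.exp_pos _), Real.exp_neg,
    inv_mul_le_iff₀ (Real.exp_pos _)]
  refine (abs_rlIntegral_le_exp hβ hlam ht fun s hs => hx s hs.1).trans_eq (by ring)

/-- Banach's fixed point theorem for `z = exp (-(lam * t)) • (w - ψ)` among bounded continuous
functions. `N` is causal in the sense of `hN`, so delays are allowed: the weight at an earlier time
is at most the weight at `s`. -/
theorem exists_volterra_solution {d : ℕ} {α : Fin d → ℝ} (hα : ∀ i, 0 < α i)
    {N : (ℝ → Fin d → ℝ) → ℝ → Fin d → ℝ} {L A : ℝ} (hL : 0 ≤ L)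
    (hNc : ∀ w, Continuous w → Continuous (N w))
    (hN : ∀ w w' s C, 0 ≤ s → (∀ σ ≤ s, ‖w σ - w' σ‖ ≤ C) → ‖N w s - N w' s‖ ≤ L * C)
    {ψ : ℝ → Fin d → ℝ} (hψ : Continuous ψ) (hA : ∀ s, 0 ≤ s → ‖N ψ s‖ ≤ A) :
    ∃ w : ℝ → Fin d → ℝ, Continuous w ∧
      ∀ t i, w t i = ψ t i + rlIntegral (α i) (fun s => N w s i) (max t 0) := by
  obtain ⟨lam, hlam1, hlam⟩ := exists_weight hα L
  have hlam0 : 0 < lam := by linarith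
  have hA0 : 0 ≤ A := (norm_nonneg _).trans (hA 0 le_rfl)
  let W : BoundedContinuousFunction ℝ (Fin d → ℝ) → ℝ → Fin d → ℝ :=
    fun z t => ψ t + Real.exp (lam * t) • z t
  have cW : ∀ z, Continuous (W z) := fun z =>
    hψ.add ((by fun_prop : Continuous fun t : ℝ => Real.exp (lam * t)).smul z.continuous)
  have cN : ∀ z i, Continuous fun s => N (W z) s i := fun z i =>
    (continuous_apply i).comp (hNc _ (cW z))
  have exp_mono : ∀ {σ s : ℝ}, σ ≤ s → Real.exp (lam * σ) ≤ Real.exp (lam * s) := fun h =>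
    Real.exp_le_exp.2 (mul_le_mul_of_nonneg_left h hlam0.le)
  have hdiff : ∀ z z' s i, 0 ≤ s →
      |N (W z) s i - N (W z') s i| ≤ L * dist z z' * Real.exp (lam * s) := by
    intro z z' s i hs
    refine (norm_le_pi_norm (N (W z) s - N (W z') s) i).trans ?_
    rw [mul_assoc]
    refine hN _ _ s _ hs fun σ hσ => ?_
    simp only [W, add_sub_add_left_eq_sub, ← smul_sub, norm_smul,
      Real.norm_of_nonneg (Real.exp_pos _).le]
    rw [mul_comm, ← dist_eq_norm]
    exact mul_le_mul (BoundedContinuousFunction.dist_coe_le_dist σ) (exp_mono hσ)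
      (Real.exp_pos _).le dist_nonneg
  have hbd : ∀ z s i, 0 ≤ s → |N (W z) s i| ≤ (A + L * ‖z‖) * Real.exp (lam * s) := by
    intro z s i hs
    have h0 : W 0 = ψ := by ext t i; simp [W]
    have h1 := hdiff z 0 s i hs
    rw [h0, dist_zero_right] at h1
    have h2 : |N ψ s i| ≤ A := (norm_le_pi_norm (N ψ s) i).trans (hA s hs)
    have h3 : 1 ≤ Real.exp (lam * s) := Real.one_le_exp (by positivity)
    have h4 := abs_sub_abs_le_abs_sub (N (W z) s i) (N ψ s i)
    nlinarith
  let S : BoundedContinuousFunction ℝ (Fin d → ℝ) → ℝ → Fin d → ℝ :=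
    fun z t i => Real.exp (-(lam * t)) * rlIntegral (α i) (fun s => N (W z) s i) (max t 0)
  have cS : ∀ z, Continuous (S z) := fun z => continuous_pi fun i =>
    (by fun_prop : Continuous fun t : ℝ => Real.exp (-(lam * t))).mul
      (continuous_rlIntegral (hα i).le (cN z i))
  have bS : ∀ z t, ‖S z t‖ ≤ A + L * ‖z‖ := by
    intro z t
    have hnn : 0 ≤ A + L * ‖z‖ := by positivity
    refine (pi_norm_le_iff_of_nonneg hnn).2 fun i => ?_
    refine (weighted_rlIntegral_le (hα i) hlam0 hnn (fun s hs => hbd z s i hs) t).trans ?_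
    refine mul_le_of_le_one_right hnn (Real.rpow_le_one (by positivity) ?_ (hα i).le)
    rw [div_le_one hlam0]; exact hlam1
  let T : BoundedContinuousFunction ℝ (Fin d → ℝ) → BoundedContinuousFunction ℝ (Fin d → ℝ) :=
    fun z => BoundedContinuousFunction.ofNormedAddCommGroup (S z) (cS z) _ (bS z)
  have hT : ContractingWith (1 / 2) T := by
    refine ⟨by rw [← NNReal.coe_lt_coe]; norm_num, LipschitzWith.of_dist_le_mul fun z z' => ?_⟩
    have hnn : (0 : ℝ) ≤ ((1 / 2 : NNReal) : ℝ) * dist z z' := by positivity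
    refine (BoundedContinuousFunction.dist_le hnn).2 fun t => (dist_pi_le_iff hnn).2 fun i => ?_
    change dist (S z t i) (S z' t i) ≤ _
    rw [Real.dist_eq]
    simp only [S]
    rw [← mul_sub, ← rlIntegral_sub (hα i).le (cN z i) (cN z' i)]
    refine (weighted_rlIntegral_le (hα i) hlam0 (mul_nonneg hL dist_nonneg)
      (fun s hs => hdiff z z' s i hs) t).trans ?_
    rw [mul_right_comm]
    refine mul_le_mul_of_nonneg_right ((hlam i).trans_eq (by norm_num)) dist_nonneg
  set z := ContractingWith.fixedPoint T hT with hz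
  have hfix : T z = z := hT.fixedPoint_isFixedPt
  refine ⟨W z, cW z, fun t i => ?_⟩
  have h1 : z t i = S z t i := by
    conv_lhs => rw [← hfix]
    rfl
  have h2 : W z t i = ψ t i + Real.exp (lam * t) * z t i := rfl
  rw [h2, h1]
  simp only [S]
  rw [← mul_assoc, ← Real.exp_add, add_neg_cancel, Real.exp_zero, one_mul]

/-- At a maximum of `exp (-(lam * t)) * ‖δ t‖` the integral equation bounds this maximum by half of
itself. -/
theorem eq_zero_of_volterra_bound {d : ℕ} {α : Fin d → ℝ} (hα : ∀ i, 0 < α i) {b L : ℝ}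
    (hb : 0 ≤ b) {δ : ℝ → Fin d → ℝ} (hδ : ContinuousOn δ (Icc 0 b)) {k : ℝ → Fin d → ℝ}
    (hk : ∀ t ∈ Icc 0 b, ∀ i, δ t i = rlIntegral (α i) (fun s => k s i) t)
    (hkL : ∀ s ∈ Icc 0 b, ∀ C, (∀ σ ∈ Icc 0 s, ‖δ σ‖ ≤ C) → ‖k s‖ ≤ L * C) :
    ∀ t ∈ Icc 0 b, δ t = 0 := by
  obtain ⟨lam, hlam1, hlam⟩ := exists_weight hα L
  have hlam0 : 0 < lam := by linarith
  obtain ⟨t₀, ht₀, hmax⟩ := isCompact_Icc.exists_isMaxOn (nonempty_Icc.2 hb)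
    (f := fun t => Real.exp (-(lam * t)) * ‖δ t‖) (by fun_prop)
  set M := Real.exp (-(lam * t₀)) * ‖δ t₀‖ with hM
  have hM0 : 0 ≤ M := by positivity
  have hδM : ∀ t ∈ Icc 0 b, ‖δ t‖ ≤ M * Real.exp (lam * t) := by
    intro t ht
    have h : Real.exp (-(lam * t)) * ‖δ t‖ ≤ M := hmax ht
    rwa [Real.exp_neg, inv_mul_le_iff₀ (Real.exp_pos _), mul_comm] at h
  have hle : ‖δ t₀‖ ≤ 1 / 2 * M * Real.exp (lam * t₀) := by
    refine (pi_norm_le_iff_of_nonneg (by positivity)).2 fun i => ?_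
    rw [hk t₀ ht₀ i]
    refine (abs_rlIntegral_le_exp (C := L * M) (hα i) hlam0 ht₀.1 fun s hs => ?_).trans ?_
    · refine (norm_le_pi_norm (k s) i).trans ?_
      rw [mul_assoc]
      refine hkL s ⟨hs.1, hs.2.trans ht₀.2⟩ _ fun σ hσ => ?_
      refine (hδM σ ⟨hσ.1, hσ.2.trans (hs.2.trans ht₀.2)⟩).trans ?_
      exact mul_le_mul_of_nonneg_left
        (Real.exp_le_exp.2 (mul_le_mul_of_nonneg_left hσ.2 hlam0.le)) hM0
    · rw [mul_right_comm L M]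
      exact mul_le_mul_of_nonneg_right (mul_le_mul_of_nonneg_right (hlam i) hM0)
        (Real.exp_pos _).le
  have hM' : M ≤ 1 / 2 * M := by
    rw [hM, Real.exp_neg, inv_mul_le_iff₀ (Real.exp_pos _), ← Real.exp_neg, ← hM]
    linarith
  intro t ht
  have h := hδM t ht
  have : M = 0 := by linarith
  rw [this, zero_mul] at h
  exact norm_le_zero_iff.1 h

/-! ### Uniqueness for the delay system. -/

/-- `f` is Lipschitz on every ball centred at the origin. -/
def LipschitzOnBalls {d : ℕ} (f : (Fin d → ℝ) → (Fin d → ℝ)) : Prop :=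
  ∀ R, 0 ≤ R → ∃ L, 0 ≤ L ∧ ∀ x y, ‖x‖ ≤ R → ‖y‖ ≤ R → ‖f x - f y‖ ≤ L * ‖x - y‖

theorem IsSolutionOn.eq_add_rlIntegral {d m : ℕ} {α : Fin d → ℝ}
    (hα : ∀ i, 0 < α i ∧ α i ≤ 1) {f : (Fin d → ℝ) → (Fin d → ℝ)}
    {g : Fin m → (Fin d → ℝ) → (Fin d → ℝ)} {τ : Fin m → ℝ → ℝ} {r : ℝ}
    {φ : C(Set.Icc (-r) 0, Fin d → ℝ)} {T : EReal} {u : ℝ → Fin d → ℝ}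
    (hr : 0 ≤ r) (hτ : ∀ j, ContinuousOn (τ j) (Ici 0))
    (hτr : ∀ j t, 0 ≤ t → 0 ≤ τ j t ∧ τ j t ≤ r)
    (hf : Continuous f) (hg : ∀ j, Continuous (g j)) (hu : IsSolutionOn α f g τ φ T u)
    {b : ℝ} (hb : 0 < b) (hbT : (b : EReal) < T) (i : Fin d) :
    ContinuousOn (fun t => f (u t) i + ∑ j, g j (u (t - τ j t)) i) (Icc 0 b) ∧
      ∀ t ∈ Icc 0 b, u t i =
        u 0 i + rlIntegral (α i) (fun t => f (u t) i + ∑ j, g j (u (t - τ j t)) i) t := by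
  have hlt : ∀ t : ℝ, t ≤ b → (t : EReal) < T := fun t ht =>
    (EReal.coe_le_coe_iff.2 ht).trans_lt hbT
  have cu : ContinuousOn u (Icc 0 b) :=
    hu.continuousOn.mono fun t ht => ⟨by linarith [ht.1], hlt t ht.2⟩
  have cd : ∀ j, ContinuousOn (fun t => u (t - τ j t)) (Icc 0 b) := fun j =>
    hu.continuousOn.comp (continuousOn_id.sub ((hτ j).mono fun t ht => ht.1)) fun t ht => by
      have h := hτr j t ht.1
      refine ⟨?_, hlt _ ?_⟩
      · linarith [ht.1]
      · linarith [ht.2]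
  have ck : ContinuousOn (fun t => f (u t) i + ∑ j, g j (u (t - τ j t)) i) (Icc 0 b) := by
    refine ContinuousOn.add ?_ (continuousOn_finsetSum _ fun j _ => ?_)
    · exact ((continuous_apply i).comp hf).comp_continuousOn cu
    · exact ((continuous_apply i).comp (hg j)).comp_continuousOn (cd j)
  refine ⟨ck, ?_⟩
  exact eq_add_rlIntegral_of_hasCaputoDerivAt (hα i).1 (hα i).2
    ((continuous_apply i).comp_continuousOn cu) ck
    (fun t ht => hu.equation t ht.1 (hlt t ht.2.le) i) hb

theorem IsSolutionOn.eq_of_lt {d m : ℕ} {α : Fin d → ℝ}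
    (hα : ∀ i, 0 < α i ∧ α i ≤ 1) {f : (Fin d → ℝ) → (Fin d → ℝ)}
    {g : Fin m → (Fin d → ℝ) → (Fin d → ℝ)} {τ : Fin m → ℝ → ℝ} {r : ℝ}
    {φ : C(Set.Icc (-r) 0, Fin d → ℝ)} {T T' : EReal} {u w : ℝ → Fin d → ℝ}
    (hr : 0 ≤ r) (hτ : ∀ j, ContinuousOn (τ j) (Ici 0))
    (hτr : ∀ j t, 0 ≤ t → 0 ≤ τ j t ∧ τ j t ≤ r)
    (hf : Continuous f) (hg : ∀ j, Continuous (g j))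
    (hfL : LipschitzOnBalls f) (hgL : ∀ j, LipschitzOnBalls (g j))
    (hu : IsSolutionOn α f g τ φ T u) (hw : IsSolutionOn α f g τ φ T' w)
    {t : ℝ} (htr : -r ≤ t) (htT : (t : EReal) < T) (htT' : (t : EReal) < T') : u t = w t := by
  have hpast : ∀ s, -r ≤ s → s ≤ 0 → u s = w s := fun s h1 h2 =>
    (hu.initial ⟨s, h1, h2⟩).trans (hw.initial ⟨s, h1, h2⟩).symm
  rcases le_or_gt t 0 with ht | ht
  · exact hpast t htr ht
  have hbd : ∀ {S : EReal} {x : ℝ → Fin d → ℝ}, IsSolutionOn α f g τ φ S x → (t : EReal) < S →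
      ∃ R, ∀ s ∈ Icc (-r) t, ‖x s‖ ≤ R := fun hx hS =>
    isCompact_Icc.exists_bound_of_continuousOn (hx.continuousOn.mono fun s hs =>
      ⟨hs.1, (EReal.coe_le_coe_iff.2 hs.2).trans_lt hS⟩)
  obtain ⟨R₁, hR₁⟩ := hbd hu htT
  obtain ⟨R₂, hR₂⟩ := hbd hw htT'
  set R := max R₁ R₂ with hR
  have hR0 : 0 ≤ R := (norm_nonneg _).trans ((hR₁ t ⟨htr, le_rfl⟩).trans (le_max_left _ _))
  have hRu : ∀ s ∈ Icc (-r) t, ‖u s‖ ≤ R := fun s hs => (hR₁ s hs).trans (le_max_left _ _)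
  have hRw : ∀ s ∈ Icc (-r) t, ‖w s‖ ≤ R := fun s hs => (hR₂ s hs).trans (le_max_right _ _)
  obtain ⟨Lf, hLf0, hLf⟩ := hfL R hR0
  choose Lg hLg0 hLg using fun j => hgL j R hR0
  have hu0 : u 0 = w 0 := hpast 0 (by linarith) le_rfl
  have hδ := eq_zero_of_volterra_bound (fun i => (hα i).1) ht.le (L := Lf + ∑ j, Lg j)
    (δ := fun s => u s - w s)
    (k := fun s => (f (u s) + ∑ j, g j (u (s - τ j s))) - (f (w s) + ∑ j, g j (w (s - τ j s))))
    ?_ ?_ ?_ t ⟨ht.le, le_rfl⟩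
  · exact sub_eq_zero.1 hδ
  · exact (hu.continuousOn.mono fun s hs =>
        ⟨by linarith [hs.1], (EReal.coe_le_coe_iff.2 hs.2).trans_lt htT⟩).sub
      (hw.continuousOn.mono fun s hs =>
        ⟨by linarith [hs.1], (EReal.coe_le_coe_iff.2 hs.2).trans_lt htT'⟩)
  · intro s hs i
    obtain ⟨cu, eu⟩ := hu.eq_add_rlIntegral hα hr hτ hτr hf hg ht htT i
    obtain ⟨cw, ew⟩ := hw.eq_add_rlIntegral hα hr hτ hτr hf hg ht htT' i
    have hsub : uIcc 0 s ⊆ Icc 0 t := by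
      rw [uIcc_of_le hs.1]; exact Icc_subset_Icc_right hs.2
    simp only [Pi.sub_apply, Pi.add_apply, Finset.sum_apply]
    rw [rlIntegral_sub_of_continuousOn (hα i).1.le (cu.mono hsub) (cw.mono hsub), eu s hs, ew s hs,
      hu0, add_sub_add_left_eq_sub]
  · intro s hs C hC
    have hC0 : 0 ≤ C := (norm_nonneg _).trans (hC s ⟨hs.1, le_rfl⟩)
    have hs' : s ∈ Icc (-r) t := ⟨by linarith [hs.1], hs.2⟩
    have h1 : ‖f (u s) - f (w s)‖ ≤ Lf * C :=
      (hLf _ _ (hRu s hs') (hRw s hs')).trans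
        (mul_le_mul_of_nonneg_left (hC s ⟨hs.1, le_rfl⟩) hLf0)
    have h2 : ∀ j, ‖g j (u (s - τ j s)) - g j (w (s - τ j s))‖ ≤ Lg j * C := by
      intro j
      have hj := hτr j s hs.1
      have hσ : s - τ j s ∈ Icc (-r) t := ⟨by linarith [hs.1], by linarith [hs.2]⟩
      refine (hLg j _ _ (hRu _ hσ) (hRw _ hσ)).trans
        (mul_le_mul_of_nonneg_left ?_ (hLg0 j))
      -- A delayed time is either in `[0, s]`, where `C` applies, or in the history, where both
      -- solutions agree.
      rcases le_total 0 (s - τ j s) with h | h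
      · exact hC _ ⟨h, by linarith⟩
      · rw [hpast _ hσ.1 h, sub_self, norm_zero]; exact hC0
    rw [add_sub_add_comm, ← Finset.sum_sub_distrib, add_mul, Finset.sum_mul]
    exact (norm_add_le _ _).trans (add_le_add h1 (norm_sum_le_of_le _ fun j _ => h2 j))

/-! ### Truncation and invariant boxes. -/

/-- Componentwise truncation to the box `[0, e]`. -/
def clip {d : ℕ} (e x : Fin d → ℝ) : Fin d → ℝ := fun i => max 0 (min (x i) (e i))

section clip
variable {d : ℕ} {e : Fin d → ℝ}

theorem continuous_clip : Continuous (clip e) := by unfold clip; fun_prop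

theorem clip_nonneg (x : Fin d → ℝ) : 0 ≤ clip e x := fun _ => le_max_left _ _

theorem clip_le (he : 0 ≤ e) (x : Fin d → ℝ) : clip e x ≤ e := fun i =>
  max_le (he i) (min_le_right _ _)

theorem clip_of_mem {x : Fin d → ℝ} (h0 : 0 ≤ x) (h1 : x ≤ e) : clip e x = x := by
  ext i
  simp only [clip, min_eq_left (h1 i)]
  exact max_eq_right (h0 i)

theorem clip_apply_of_nonpos {x : Fin d → ℝ} {i : Fin d} (h : x i ≤ 0) : clip e x i = 0 :=
  max_eq_left ((min_le_left _ _).trans h)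

theorem clip_apply_of_ge (he : 0 ≤ e) {x : Fin d → ℝ} {i : Fin d} (h : e i ≤ x i) :
    clip e x i = e i := by
  simp only [clip, min_eq_right h]
  exact max_eq_right (he i)

theorem norm_clip_sub_clip_le (x y : Fin d → ℝ) : ‖clip e x - clip e y‖ ≤ ‖x - y‖ := by
  refine (pi_norm_le_iff_of_nonneg (norm_nonneg _)).2 fun i => ?_
  refine le_trans ?_ (norm_le_pi_norm (x - y) i)
  simp only [Pi.sub_apply, clip, Real.norm_eq_abs]
  calc |max 0 (min (x i) (e i)) - max 0 (min (y i) (e i))|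
      ≤ |min (x i) (e i) - min (y i) (e i)| := by
        simpa using abs_max_sub_max_le_max 0 (min (x i) (e i)) 0 (min (y i) (e i))
    _ ≤ |x i - y i| := by
        simpa using abs_min_sub_min_le_max (x i) (e i) (y i) (e i)

theorem norm_clip_le (he : 0 ≤ e) (x : Fin d → ℝ) : ‖clip e x‖ ≤ ‖e‖ :=
  (pi_norm_le_iff_of_nonneg (norm_nonneg _)).2 fun i => by
    rw [Real.norm_of_nonneg (clip_nonneg x i)]
    exact (clip_le he x i).trans ((le_abs_self _).trans (norm_le_pi_norm e i))

end clip

/-- A box `[0, e]` at whose upper faces the field points inwards is invariant: there is a global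
solution inside the box. -/
theorem exists_solution_in_box {d m : ℕ} {α : Fin d → ℝ}
    (hα : ∀ i, 0 < α i ∧ α i ≤ 1) {f : (Fin d → ℝ) → (Fin d → ℝ)}
    {g : Fin m → (Fin d → ℝ) → (Fin d → ℝ)} {τ : Fin m → ℝ → ℝ} {r : ℝ}
    {φ : C(Set.Icc (-r) 0, Fin d → ℝ)}
    (hr : 0 ≤ r) (hτ : ∀ j, ContinuousOn (τ j) (Ici 0))
    (hτr : ∀ j t, 0 ≤ t → 0 ≤ τ j t ∧ τ j t ≤ r)
    (hf : IsCooperative f) (hg : ∀ j, Continuous (g j)) (hgm : ∀ j, MonotoneOn (g j) (Ici 0))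
    (hf0 : f 0 = 0) (hg0 : ∀ j, g j 0 = 0)
    (hfL : LipschitzOnBalls f) (hgL : ∀ j, LipschitzOnBalls (g j))
    {e : Fin d → ℝ} (he : 0 ≤ e) (hS : ∀ i, f e i + ∑ j, g j e i ≤ 0)
    (hφ0 : ∀ s, 0 ≤ φ s) (hφe : ∀ s, φ s ≤ e) :
    ∃ w, IsSolutionOn α f g τ φ ⊤ w ∧ ∀ t, 0 ≤ w t ∧ w t ≤ e := by
  have hr' : -r ≤ 0 := by linarith
  set ψ : ℝ → Fin d → ℝ := IccExtend hr' φ with hψ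
  have cψ : Continuous ψ := φ.continuous.Icc_extend'
  have ψ0 : ∀ t, 0 ≤ ψ t := fun t => hφ0 _
  have ψe : ∀ t, ψ t ≤ e := fun t => hφe _
  have ψpos : ∀ t, 0 ≤ t → ψ t = ψ 0 := fun t ht => by
    simp only [hψ, IccExtend_of_right_le hr' φ ht, IccExtend_of_right_le hr' φ le_rfl]
  have cσ : ∀ j, Continuous fun t => t - τ j (max t 0) := fun j =>
    continuous_id.sub ((hτ j).comp_continuous (by fun_prop) fun t => le_max_right t 0)
  -- The restoring term `clip e w - w` turns the weak inequalities on the faces into the strict sign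
  -- that the minimum principle needs. The delay is evaluated at `max s 0` because it is controlled
  -- only at nonnegative times.
  let N : (ℝ → Fin d → ℝ) → ℝ → Fin d → ℝ := fun w s =>
    f (clip e (w s)) + (clip e (w s) - w s) + ∑ j, g j (clip e (w (s - τ j (max s 0))))
  obtain ⟨Lf, hLf0, hLf⟩ := hfL ‖e‖ (norm_nonneg _)
  choose Lg hLg0 hLg using fun j => hgL j ‖e‖ (norm_nonneg _)
  have hNc : ∀ w, Continuous w → Continuous (N w) := fun w cw =>
    ((hf.continuous.comp (continuous_clip.comp cw)).add ((continuous_clip.comp cw).sub cw)).add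
      (continuous_finsetSum _ fun j _ => (hg j).comp (continuous_clip.comp (cw.comp (cσ j))))
  have hN : ∀ w w' s C, 0 ≤ s → (∀ σ ≤ s, ‖w σ - w' σ‖ ≤ C) →
      -- The `2` is the Lipschitz constant of the restoring term.
      ‖N w s - N w' s‖ ≤ (Lf + 2 + ∑ j, Lg j) * C := by
    intro w w' s C hs hC
    have hP : ∀ σ ≤ s, ‖clip e (w σ) - clip e (w' σ)‖ ≤ C := fun σ hσ =>
      (norm_clip_sub_clip_le _ _).trans (hC σ hσ)
    have h1 : ‖f (clip e (w s)) - f (clip e (w' s))‖ ≤ Lf * C :=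
      (hLf _ _ (norm_clip_le he _) (norm_clip_le he _)).trans
        (mul_le_mul_of_nonneg_left (hP s le_rfl) hLf0)
    have h2 : ‖(clip e (w s) - w s) - (clip e (w' s) - w' s)‖ ≤ 2 * C := by
      rw [sub_sub_sub_comm, two_mul]
      exact (norm_sub_le _ _).trans (add_le_add (hP s le_rfl) (hC s le_rfl))
    have h3 : ∀ j, ‖g j (clip e (w (s - τ j (max s 0)))) -
        g j (clip e (w' (s - τ j (max s 0))))‖ ≤ Lg j * C := fun j =>
      (hLg j _ _ (norm_clip_le he _) (norm_clip_le he _)).trans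
        (mul_le_mul_of_nonneg_left
          (hP _ (by linarith [(hτr j (max s 0) (le_max_right _ _)).1])) (hLg0 j))
    simp only [N]
    rw [add_sub_add_comm, add_sub_add_comm, ← Finset.sum_sub_distrib, add_mul, add_mul,
      Finset.sum_mul]
    exact (norm_add_le _ _).trans (add_le_add ((norm_add_le _ _).trans (add_le_add h1 h2))
      (norm_sum_le_of_le _ fun j _ => h3 j))
  have hbd : ∀ {F : (Fin d → ℝ) → (Fin d → ℝ)} {M : ℝ}, F 0 = 0 →
      (∀ x y, ‖x‖ ≤ ‖e‖ → ‖y‖ ≤ ‖e‖ → ‖F x - F y‖ ≤ M * ‖x - y‖) → 0 ≤ M →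
      ∀ x, ‖F (clip e x)‖ ≤ M * ‖e‖ := by
    intro F M hF hM hM0 x
    have h := hM (clip e x) 0 (norm_clip_le he x) (by simp)
    rw [hF, sub_zero, sub_zero] at h
    exact h.trans (mul_le_mul_of_nonneg_left (norm_clip_le he x) hM0)
  have hA : ∀ s, 0 ≤ s → ‖N ψ s‖ ≤ Lf * ‖e‖ + ∑ j, Lg j * ‖e‖ := by
    intro s _
    have h0 : clip e (ψ s) - ψ s = 0 := by rw [clip_of_mem (ψ0 s) (ψe s), sub_self]
    simp only [N]
    rw [h0, add_zero]
    exact (norm_add_le _ _).trans (add_le_add (hbd hf0 hLf hLf0 _)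
      (norm_sum_le_of_le _ fun j _ => hbd (hg0 j) (hLg j) (hLg0 j) _))
  obtain ⟨w, cw, hw⟩ := exists_volterra_solution (fun i => (hα i).1)
    (add_nonneg (add_nonneg hLf0 zero_le_two) (Finset.sum_nonneg fun j _ => hLg0 j)) hNc hN cψ hA
  have cN : ∀ i, Continuous fun s => N w s i := fun i => (continuous_apply i).comp (hNc w cw)
  have hwψ : ∀ t ≤ 0, w t = ψ t := fun t ht => by
    ext i
    rw [hw, max_eq_right ht, rlIntegral_at_zero (hα i).1, add_zero]
  have hw' : ∀ t, 0 ≤ t → ∀ i, w t i = ψ 0 i + rlIntegral (α i) (fun s => N w s i) t :=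
    fun t ht i => by rw [hw, max_eq_left ht, ψpos t ht]
  have hNi : ∀ s i, N w s i = f (clip e (w s)) i + (clip e (w s) i - w s i) +
      ∑ j, g j (clip e (w (s - τ j (max s 0)))) i := fun s i => by
    simp only [N, Pi.add_apply, Pi.sub_apply, Finset.sum_apply]
  have hlow : ∀ t, 0 ≤ t → ∀ i, 0 ≤ w t i := by
    intro t ht i
    refine nonneg_of_eq_add_rlIntegral (hα i).1 (hα i).2 (cN i) ((continuous_apply i).comp cw)
      (b := t) (fun s hs => hw' s hs.1 i) (ψ0 0 i) (fun s hs hneg => ?_) t ⟨ht, le_rfl⟩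
    replace hneg : w s i < 0 := hneg
    have hc := clip_apply_of_nonpos (e := e) hneg.le
    -- The truncation has `i`-th component `0`, so cooperativity compares it with the origin; the
    -- restoring term equals `-w s i > 0`.
    have h1 : 0 ≤ f (clip e (w s)) i := by
      have h := hf.apply_le_apply le_rfl (clip_nonneg (e := e) (w s)) (i := i) hc.symm
      rwa [hf0] at h
    have h2 : 0 ≤ ∑ j, g j (clip e (w (s - τ j (max s 0)))) i :=
      Finset.sum_nonneg fun j _ => by
        have h := hgm j (mem_Ici.2 le_rfl) (mem_Ici.2 (clip_nonneg _))
          (clip_nonneg (e := e) (w (s - τ j (max s 0)))) i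
        rwa [hg0 j] at h
    rw [hNi, hc]
    linarith
  have hupp : ∀ t, 0 ≤ t → ∀ i, 0 ≤ e i - w t i := by
    intro t ht i
    refine nonneg_of_eq_add_rlIntegral (h := fun s => -N w s i) (hα i).1 (hα i).2 (cN i).neg
      (u := fun t => e i - w t i) (u₀ := e i - ψ 0 i)
      (continuous_const.sub ((continuous_apply i).comp cw)) (b := t)
      (fun s hs => ?_) (sub_nonneg.2 (ψe 0 i)) (fun s hs hneg => ?_) t ⟨ht, le_rfl⟩
    · simp only [rlIntegral_neg, hw' s hs.1 i]; ring
    have hgt : e i < w s i := by linarith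
    have hc := clip_apply_of_ge he hgt.le
    -- Here the truncation touches the upper face, so cooperativity compares it with the corner `e`;
    -- the restoring term `e i - w s i` is negative.
    have h1 : f (clip e (w s)) i ≤ f e i :=
      hf.apply_le_apply (clip_nonneg _) (clip_le he _) hc
    have h2 : ∑ j, g j (clip e (w (s - τ j (max s 0)))) i ≤ ∑ j, g j e i :=
      Finset.sum_le_sum fun j _ => hgm j (mem_Ici.2 (clip_nonneg _)) (mem_Ici.2 he)
        (clip_le he _) i
    have h3 := hS i
    simp only [hNi, hc]
    linarith
  have hbox : ∀ t, 0 ≤ w t ∧ w t ≤ e := by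
    intro t
    rcases le_total t 0 with ht | ht
    · rw [hwψ t ht]; exact ⟨ψ0 t, ψe t⟩
    · exact ⟨hlow t ht, fun i => sub_nonneg.1 (hupp t ht i)⟩
  refine ⟨w, ⟨cw.continuousOn, fun s => ?_, fun t ht _ i => ?_⟩, hbox⟩
  · rw [hwψ s s.2.2, hψ, IccExtend_val]
  · have h := hasCaputoDerivAt_of_eq_add_rlIntegral (hα i).1 (hα i).2 (cN i)
      (u := fun s => w s i) (fun s hs => hw' s hs i) ht
    have hclip : ∀ s, clip e (w s) = w s := fun s => clip_of_mem (hbox s).1 (hbox s).2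
    simpa only [hNi, hclip, sub_self, add_zero, max_eq_left ht.le] using h

/-! ### Weighted norms and the conclusion. -/

theorem wnorm_le {d : ℕ} [Nonempty (Fin d)] {v w : Fin d → ℝ} (hv : ∀ i, 0 < v i) {c : ℝ}
    (h0 : 0 ≤ w) (h : w ≤ c • v) : wnorm v w ≤ c :=
  ciSup_le fun i => by
    rw [abs_of_nonneg (h0 i), div_le_iff₀ (hv i)]
    exact h i

theorem abs_div_le_wnorm {d : ℕ} (v w : Fin d → ℝ) (i : Fin d) : |w i| / v i ≤ wnorm v w :=
  le_ciSup (f := fun i => |w i| / v i) (finite_range _).bddAbove i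

theorem wnorm_nonneg {d : ℕ} {v : Fin d → ℝ} (hv : ∀ i, 0 < v i) (w : Fin d → ℝ) :
    0 ≤ wnorm v w :=
  Real.iSup_nonneg fun i => div_nonneg (abs_nonneg _) (hv i).le

theorem wnorm_le_histNorm {d : ℕ} [Nonempty (Fin d)] {r : ℝ} {v : Fin d → ℝ}
    (hv : ∀ i, 0 < v i) (φ : C(Set.Icc (-r) 0, Fin d → ℝ)) (s : Set.Icc (-r) 0) :
    wnorm v (φ s) ≤ histNorm v φ := by
  refine le_ciSup (f := fun s => wnorm v (φ s)) ⟨∑ i, ‖φ‖ / v i, ?_⟩ s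
  rintro _ ⟨s, rfl⟩
  refine ciSup_le fun i => ?_
  have h1 : |φ s i| ≤ ‖φ‖ := (norm_le_pi_norm (φ s) i).trans (φ.norm_coe_le_norm s)
  refine (div_le_div_of_nonneg_right h1 (hv i).le).trans ?_
  exact Finset.single_le_sum (f := fun i => ‖φ‖ / v i)
    (fun k _ => div_nonneg (norm_nonneg _) (hv k).le) (Finset.mem_univ i)

theorem le_histNorm_smul {d : ℕ} [Nonempty (Fin d)] {r : ℝ} {v : Fin d → ℝ}
    (hv : ∀ i, 0 < v i) (φ : C(Set.Icc (-r) 0, Fin d → ℝ)) (s : Set.Icc (-r) 0) :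
    φ s ≤ histNorm v φ • v := fun i => by
  have h := (abs_div_le_wnorm v (φ s) i).trans (wnorm_le_histNorm hv φ s)
  rw [div_le_iff₀ (hv i)] at h
  exact (le_abs_self _).trans h

theorem histNorm_nonneg {d : ℕ} {r : ℝ} {v : Fin d → ℝ} (hv : ∀ i, 0 < v i)
    (φ : C(Set.Icc (-r) 0, Fin d → ℝ)) : 0 ≤ histNorm v φ :=
  Real.iSup_nonneg fun s => wnorm_nonneg hv (φ s)

/-- Both cases of the theorem use their assumption on the degrees only through `hpow`, which makes
the field at the corner of the box nonpositive. The box may degenerate to the origin when the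
history vanishes. -/
theorem exists_isGlobalSolution {d m : ℕ} (hd : 1 ≤ d)
    {α : Fin d → ℝ} (hα : ∀ i, 0 < α i ∧ α i ≤ 1) {r : ℝ} (hr : 0 ≤ r)
    {τ : Fin m → ℝ → ℝ} (hτ : ∀ j, ContinuousOn (τ j) (Ici 0))
    (hτr : ∀ j t, 0 ≤ t → 0 ≤ τ j t ∧ τ j t ≤ r)
    {f : (Fin d → ℝ) → (Fin d → ℝ)} {g : Fin m → (Fin d → ℝ) → (Fin d → ℝ)}
    {p : ℝ} {q : Fin m → ℝ}
    (hp : 1 ≤ p) (hf : IsCooperative f) (hfp : IsHomogeneous p f)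
    (hq : ∀ j, p ≤ q j)
    (hgc : ∀ j, Continuous (g j)) (hgd : ∀ j, ContDiffOn ℝ 1 (g j) {0}ᶜ)
    (hgm : ∀ j, MonotoneOn (g j) (Ici 0))
    (hgq : ∀ j, IsHomogeneous (q j) (g j))
    {v : Fin d → ℝ} (hv : ∀ i, 0 < v i) (hS : ∀ i, f v i + ∑ j, g j v i < 0)
    (φ : C(Icc (-r) 0, Fin d → ℝ)) (hφ : ∀ s, 0 ≤ φ s)
    (hpow : ∀ j, histNorm v φ ^ q j ≤ histNorm v φ ^ p) :
    ∃ Φ : ℝ → Fin d → ℝ, IsGlobalSolution α f g τ φ Φ ∧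
      ∀ t, 0 ≤ t → 0 ≤ Φ t ∧ wnorm v (Φ t) ≤ histNorm v φ := by
  have : Nonempty (Fin d) := ⟨⟨0, hd⟩⟩
  have hq1 : ∀ j, 1 ≤ q j := fun j => hp.trans (hq j)
  have hc := histNorm_nonneg hv φ
  have hv0 : 0 ≤ v := fun i => (hv i).le
  have hg0 : ∀ j, g j 0 = 0 := fun j => (hgq j).map_zero (hq1 j)
  have hfL : LipschitzOnBalls f := fun R hR =>
    hfp.exists_lipschitz hp hf.continuous hf.contDiffOn hR
  have hgL : ∀ j, LipschitzOnBalls (g j) := fun j R hR =>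
    (hgq j).exists_lipschitz (hq1 j) (hgc j) (hgd j) hR
  have hface : ∀ i, f (histNorm v φ • v) i + ∑ j, g j (histNorm v φ • v) i ≤ 0 := by
    intro i
    have h1 : ∑ j, g j (histNorm v φ • v) i ≤ ∑ j, histNorm v φ ^ p * g j v i := by
      refine Finset.sum_le_sum fun j _ => ?_
      rw [(hgq j).map_smul_of_nonneg (hq1 j) hc, Pi.smul_apply, smul_eq_mul]
      refine mul_le_mul_of_nonneg_right (hpow j) ?_
      have h := hgm j (mem_Ici.2 le_rfl) (mem_Ici.2 hv0) hv0 i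
      rwa [hg0 j] at h
    rw [hfp.map_smul_of_nonneg hp hc, Pi.smul_apply, smul_eq_mul]
    rw [← Finset.mul_sum] at h1
    have h2 := mul_nonpos_of_nonneg_of_nonpos (Real.rpow_nonneg hc p) (hS i).le
    linarith
  obtain ⟨w, hw, hbox⟩ := exists_solution_in_box hα hr hτ hτr hf hgc hgm (hfp.map_zero hp) hg0
    hfL hgL (smul_nonneg hc hv0) hface hφ (le_histNorm_smul hv φ)
  refine ⟨w, ⟨hw, fun T u _ hu t ht htT => ?_⟩, fun t _ => ⟨(hbox t).1, ?_⟩⟩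
  · exact hu.eq_of_lt hα hr hτ hτr hf.continuous hgc hfL hgL hw ht htT (EReal.coe_lt_top t)
  · exact wnorm_le hv (hbox t).1 (hbox t).2

end FracDelay

theorem proposition3p2 {d m : ℕ} (hd : 1 ≤ d) (hm : 1 ≤ m)
    -- fractional orders
    (α : Fin d → ℝ) (hα : ∀ i, 0 < α i ∧ α i ≤ 1)
    -- delays, bounded by ρ j; r is the largest of the bounds
    (ρ : Fin m → ℝ) (r : ℝ) (hr : IsGreatest (Set.range ρ) r)
    (τ : Fin m → ℝ → ℝ) (hτ : ∀ j, ContinuousOn (τ j) (Set.Ici 0))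
    (hτρ : ∀ j t, 0 ≤ t → 0 ≤ τ j t ∧ τ j t ≤ ρ j)
    (f : (Fin d → ℝ) → (Fin d → ℝ)) (g : Fin m → (Fin d → ℝ) → (Fin d → ℝ))
    (p : ℝ) (q : Fin m → ℝ)
    -- (H1)
    (hp : 1 ≤ p) (hf : FracDelay.IsCooperative f) (hfp : FracDelay.IsHomogeneous p f)
    -- (H2), with the regularity of the delayed terms
    (hq : ∀ j, p ≤ q j)
    (hgc : ∀ j, Continuous (g j)) (hgd : ∀ j, ContDiffOn ℝ 1 (g j) {0}ᶜ)
    (hgm : ∀ j, MonotoneOn (g j) (Set.Ici 0))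
    (hgq : ∀ j, FracDelay.IsHomogeneous (q j) (g j))
    -- (S)
    (v : Fin d → ℝ) (hv : ∀ i, 0 < v i) (hS : ∀ i, f v i + ∑ j, g j v i < 0) :
    ((∃ j, p < q j) →
      ∀ φ : C(Set.Icc (-r) 0, Fin d → ℝ), (∀ s, 0 ≤ φ s) → FracDelay.histNorm v φ < 1 →
        ∃ Φ : ℝ → Fin d → ℝ, FracDelay.IsGlobalSolution α f g τ φ Φ ∧
          ∀ t, 0 ≤ t → 0 ≤ Φ t ∧ FracDelay.wnorm v (Φ t) ≤ FracDelay.histNorm v φ) ∧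
    ((∀ j, q j = p) →
      ∀ φ : C(Set.Icc (-r) 0, Fin d → ℝ), (∀ s, 0 ≤ φ s) →
        ∃ Φ : ℝ → Fin d → ℝ, FracDelay.IsGlobalSolution α f g τ φ Φ ∧
          ∀ t, 0 ≤ t → 0 ≤ Φ t ∧ FracDelay.wnorm v (Φ t) ≤ FracDelay.histNorm v φ) := by
  obtain ⟨⟨j₀, hj₀⟩, hmax⟩ := hr
  have hr0 : 0 ≤ r := by
    have h := hτρ j₀ 0 le_rfl
    rw [← hj₀]
    exact h.1.trans h.2
  have hτr : ∀ j t, 0 ≤ t → 0 ≤ τ j t ∧ τ j t ≤ r := fun j t ht =>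
    ⟨(hτρ j t ht).1, (hτρ j t ht).2.trans (hmax ⟨j, rfl⟩)⟩
  refine ⟨fun _ φ hφ hφ1 => ?_, fun hqp φ hφ => ?_⟩
  · refine FracDelay.exists_isGlobalSolution hd hα hr0 hτ hτr hp hf hfp hq hgc hgd hgm hgq hv hS
      φ hφ fun j => ?_
    rcases (FracDelay.histNorm_nonneg hv φ).eq_or_lt with h | h
    -- A zero history norm is treated apart, since monotonicity in the exponent is applied to a
    -- positive base; both powers vanish.
    · rw [← h, Real.zero_rpow (by linarith [hq j]), Real.zero_rpow (by linarith)]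
    · exact Real.rpow_le_rpow_of_exponent_ge h hφ1.le (hq j)
  · exact FracDelay.exists_isGlobalSolution hd hα hr0 hτ hτr hp hf hfp hq hgc hgd hgm hgq hv hS
      φ hφ fun j => by rw [hqp j]
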